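/- **Setting.** Let $f_0,f_1$ be probability densities on a measurable space with respect to a common $\sigma$-finite measure, with finite Kullback–Leibler divergence $D(f_1,f_0)=\int f_1\log(f_1/f_0)<\infty$. Let $0<\rho<1$, $0\le\pi_0<1$. The change point $\Gamma$ has $P(\Gamma=0)=\pi_0$ and $P(\Gamma=k)=(1-\pi_0)\rho(1-\rho)^{k-1}$ for $k\ge1$; given $\Gamma=l$, the observations $X_1,X_2,\dots$ are independent, $X_k$ having density $f_0$ for $k<l$ and $f_1$ for $k\ge l$. A policy $\gamma$ consists of (measurable) control laws $S_{k+1}=\mu_k(I_k)\in\{0,1\}$, $k\ge0$, and a (possibly infinite) stopping time $\tau\geq 0$ such that $\{\tau=k\}$ is determined by $I_k$, where the information vector $I_k$ consists of $S_1,\dots,S_k$ and of those $X_i$, $i\le k$, with $S_i=1$. Put $$\mathrm{ADD}(\gamma)=E[(\tau-\Gamma)^+],\qquad \mathrm{PFA}(\gamma)=P(\tau<\Gamma),\qquad \mathrm{ANO}(\gamma)=E\Big[\sum_{k=1}^{\min\{\tau,\Gamma-1\}}S_k\Big],$$ $$\Delta(\alpha,\beta)=\{\gamma:\ \mathrm{PFA}(\gamma)\le\alpha,\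 \mathrm{ANO}(\gamma)\le\beta\}.$$ Let $p_k$ be the posterior probability of $\{\Gamma\le k\}$ given $I_k$, computed by $p_0=\pi_0$ and, with $\tilde p_k=p_k+(1-p_k)\rho$ and $L=f_1/f_0$, by $p_{k+1}=\tilde p_k$ if $S_{k+1}=0$ and $p_{k+1}=\tilde p_kL(X_{k+1})/(\tilde p_kL(X_{k+1})+1-\tilde p_k)$ if $S_{k+1}=1$. For $a\in\mathbb R$ and $b\in[-\infty,\infty)$ put $A=1/(1+e^{-a})$ and $B=1/(1+e^{-b})$ ($B=0$ if $b=-\infty$). The two-threshold policy $\gamma(a,b)$ takes $S_{k+1}=1$ if and only if $p_k\ge B$, and $\tau=\inf\{k\ge1:p_k>A\}$. **Theorem.** Fix $\rho,\pi_0,f_0,f_1$ as above and $\beta>0$. Say that $b\in[-\infty,\infty)$ meets the ANO constraint as $a\to\infty$ if $\mathrm{ANO}(\gamma(a,b))\le\beta$ for all sufficiently large $a$. 1. Some $b$ meets the ANO constraint as $a\to\infty$. 2. For every $b$ that meets the ANO constraint as $a\to\infty$, and for all sufficiently small $\alpha>0$, there is a smallest real $a$ with $\mathrm{PFA}(\gamma(a,b))\le\alpha$.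 It satisfies $b<a\le\log\frac{1-\alpha}{\alpha}$, and $\gamma(a,b)\in\Delta(\alpha,\beta)$. 3. Let $a(\alpha)\in\mathbb R$ and $b(\alpha)\in[-\infty,\infty)$ be any thresholds such that, for all sufficiently small $\alpha>0$, $\gamma(a(\alpha),b(\alpha))\in\Delta(\alpha,\beta)$, $a(\alpha)\le\log\frac{1-\alpha}{\alpha}$ (the level at which $A=1-\alpha$), and $b(\alpha)\le b_{\max}$ for a real constant $b_{\max}$. Then $$\mathrm{ADD}\big(\gamma(a(\alpha),b(\alpha))\big)=\Big[\inf_{\gamma\in\Delta(\alpha,\beta)}\mathrm{ADD}(\gamma)\Big](1+o(1))\qquad\text{as }\alpha\to0.$$ In particular the two-threshold policy is asymptotically optimal when $b(\alpha)=b$ is the smallest $b$ that meets the ANO constraint as $a\to\infty$, whenever a smallest one exists (and for any other fixed $b$ that meets it), and $a(\alpha)$ is the smallest $a$ with $\mathrm{PFA}(\gamma(a,b))\le\alpha$. -/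

import Mathlib

open MeasureTheory Filter Topology
open scoped ENNReal

namespace QCD

/-- Data of the Bayesian change-point problem: observation densities `f₀` (before the change) and
`f₁` (from the change on) with respect to a common reference measure on the observation space `𝒳`,
and the parameters `ρ`, `π₀` of the geometric prior of the change point. -/
structure ChangeModel (𝒳 : Type*) [MeasurableSpace 𝒳] where
  ref : Measure 𝒳
  sigmaFinite_ref : SigmaFinite ref
  f₀ : 𝒳 → ℝ
  f₁ : 𝒳 → ℝ
  measurable_f₀ : Measurable f₀
  measurable_f₁ : Measurable f₁
  f₀_nonneg : ∀ x, 0 ≤ f₀ x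
  f₁_nonneg : ∀ x, 0 ≤ f₁ x
  lintegral_f₀ : ∫⁻ x, ENNReal.ofReal (f₀ x) ∂ref = 1
  lintegral_f₁ : ∫⁻ x, ENNReal.ofReal (f₁ x) ∂ref = 1
  ρ : ℝ
  ρ_pos : 0 < ρ
  ρ_lt_one : ρ < 1
  π₀ : ℝ
  π₀_nonneg : 0 ≤ π₀
  π₀_lt_one : π₀ < 1

/-- An observation control and stopping policy. The information vector `I_k` is a function
`Fin k → 𝒳 ⊕ Unit`, whose entry number `i - 1` is `Sum.inl X_i` if `S_i = 1` (the observation at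
time `i` is taken) and `Sum.inr ()` if `S_i = 0` (it is absent).
`take k` is the control law `μ_k`, that is `S_{k+1} = μ_k (I_k)`, and `halt k` is the stopping
decision `D_k` as a function of `I_k`. -/
structure Policy (𝒳 : Type*) [MeasurableSpace 𝒳] where
  take : (k : ℕ) → (Fin k → 𝒳 ⊕ Unit) → Bool
  halt : (k : ℕ) → (Fin k → 𝒳 ⊕ Unit) → Bool
  measurable_take : ∀ k, Measurable (take k)
  measurable_halt : ∀ k, Measurable (halt k)

namespace Policy

variable {𝒳 : Type*} [MeasurableSpace 𝒳]

/-- The information vector `I_k` that the policy `γ` has collected at time `k` when the sequence of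
observations is `X_1 = x 1`, `X_2 = x 2`, … (the coordinate `x 0` is never used). -/
def info (γ : Policy 𝒳) (x : ℕ → 𝒳) : (k : ℕ) → Fin k → 𝒳 ⊕ Unit
  | 0 => Fin.elim0
  | k + 1 => Fin.snoc (α := fun _ => 𝒳 ⊕ Unit) (info γ x k)
      (if γ.take k (info γ x k) = true then Sum.inl (x (k + 1)) else Sum.inr ())

/-- `S_k = 1`, for `k ≥ 1`. -/
def Samples (γ : Policy 𝒳) (x : ℕ → 𝒳) (k : ℕ) : Prop :=
  γ.take (k - 1) (γ.info x (k - 1)) = true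

/-- The stopping time `τ`, which is `⊤` if the policy never stops. -/
noncomputable def stopTime (γ : Policy 𝒳) (x : ℕ → 𝒳) : ℕ∞ :=
  ⨅ (k : ℕ) (_ : γ.halt k (γ.info x k) = true), (k : ℕ∞)

end Policy

namespace ChangeModel

variable {𝒳 : Type*} [MeasurableSpace 𝒳] (M : ChangeModel 𝒳)

/-- The law of one observation before the change. -/
noncomputable def P₀ : Measure 𝒳 := M.ref.withDensity fun x => ENNReal.ofReal (M.f₀ x)

/-- The law of one observation from the change on. -/
noncomputable def P₁ : Measure 𝒳 := M.ref.withDensity fun x => ENNReal.ofReal (M.f₁ x)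

/-- The prior `π_k = P(Γ = k)`. -/
noncomputable def prior (k : ℕ) : ℝ :=
  if k = 0 then M.π₀ else (1 - M.π₀) * M.ρ * (1 - M.ρ) ^ (k - 1)

/-- The law of the observation sequence given `Γ = l`: the `X_k` are independent, with law `P₀` for
`k < l` and `P₁` for `k ≥ l`. -/
noncomputable def pathLaw (l : ℕ) : Measure (ℕ → 𝒳) :=
  Measure.infinitePi fun k => if k < l then M.P₀ else M.P₁

/-- The joint law of `(Γ, (X_k))`. -/
noncomputable def law : Measure (ℕ × (ℕ → 𝒳)) :=
  Measure.sum fun l => ENNReal.ofReal (M.prior l) • (Measure.dirac l).prod (M.pathLaw l)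

/-- Average detection delay `E[(τ - Γ)⁺]`. -/
noncomputable def ADD (γ : Policy 𝒳) : ℝ≥0∞ :=
  ∫⁻ ω, ((γ.stopTime ω.2 - (ω.1 : ℕ∞) : ℕ∞) : ℝ≥0∞) ∂M.law

/-- Probability of false alarm `P(τ < Γ)`. -/
noncomputable def PFA (γ : Policy 𝒳) : ℝ≥0∞ :=
  M.law {ω | γ.stopTime ω.2 < (ω.1 : ℕ∞)}

open Classical in
/-- Average number of observations taken before the change,
`E[∑_{k = 1}^{min (τ, Γ - 1)} S_k]`. -/
noncomputable def ANO (γ : Policy 𝒳) : ℝ≥0∞ :=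
  ∫⁻ ω, ∑ k ∈ Finset.Icc 1 (ω.1 - 1),
    (if (k : ℕ∞) ≤ γ.stopTime ω.2 ∧ γ.Samples ω.2 k then (1 : ℝ≥0∞) else 0) ∂M.law

/-- `Δ(α, β)`: the policies with `PFA ≤ α` and `ANO ≤ β`. -/
def Feasible (α β : ℝ) : Set (Policy 𝒳) :=
  {γ | M.PFA γ ≤ ENNReal.ofReal α ∧ M.ANO γ ≤ ENNReal.ofReal β}

/-- The likelihood ratio. -/
noncomputable def L (x : 𝒳) : ℝ := M.f₁ x / M.f₀ x

/-- The update of the belief when the observation is skipped. -/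
noncomputable def Φ₀ (p : ℝ) : ℝ := p + (1 - p) * M.ρ

/-- The update of the belief when the observation `x` is taken. -/
noncomputable def Φ₁ (x : 𝒳) (p : ℝ) : ℝ :=
  M.Φ₀ p * M.L x / (M.Φ₀ p * M.L x + (1 - M.Φ₀ p))

/-- The belief `p_k` (posterior probability of `Γ ≤ k`) as a function of the information vector
`I_k`, given by the recursion with `p_0 = π₀`. -/
noncomputable def belief : (k : ℕ) → (Fin k → 𝒳 ⊕ Unit) → ℝ
  | 0, _ => M.π₀
  | k + 1, I => Sum.elim (fun x => M.Φ₁ x (belief k (Fin.init I)))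
      (fun _ => M.Φ₀ (belief k (Fin.init I))) (I (Fin.last k))

lemma measurable_belief (k : ℕ) : Measurable (M.belief k) := by
  induction k with
  | zero => exact measurable_const
  | succ k ih =>
    have hinit : Measurable fun I : Fin (k + 1) → 𝒳 ⊕ Unit => M.belief k (Fin.init I) :=
      ih.comp (measurable_pi_lambda _ fun i => measurable_pi_apply _)
    have hΦ₀ : Measurable fun I : Fin (k + 1) → 𝒳 ⊕ Unit => M.Φ₀ (M.belief k (Fin.init I)) := by
      unfold Φ₀; fun_prop
    have hlast : Measurable fun I : Fin (k + 1) → 𝒳 ⊕ Unit => I (Fin.last k) :=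
      measurable_pi_apply _
    have hL : Measurable M.L := M.measurable_f₁.div M.measurable_f₀
    have key : Measurable fun q : ℝ × (𝒳 ⊕ Unit) =>
        Sum.elim (fun x => M.Φ₁ x q.1) (fun _ => M.Φ₀ q.1) q.2 := by
      have h₁ : Measurable fun q : ℝ × 𝒳 => M.Φ₁ q.2 q.1 := by
        unfold Φ₁ Φ₀; fun_prop
      have h₂ : Measurable fun q : ℝ × Unit => M.Φ₀ q.1 := by
        unfold Φ₀; fun_prop
      have h := (Measurable.sumElim h₁ h₂).comp
        (MeasurableEquiv.prodSumDistrib ℝ 𝒳 Unit).measurable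
      convert h using 1
      funext ⟨p, s⟩
      cases s <;> rfl
    exact key.comp (hinit.prodMk hlast)

open Classical in
/-- The two-threshold policy `γ(A, B)` on the belief scale: `S_{k+1} = 1` iff `p_k ≥ B`, and
`τ = inf {k ≥ 1 : p_k > A}`. -/
noncomputable def beliefThreshold (A B : ℝ) : Policy 𝒳 where
  take k I := decide (B ≤ M.belief k I)
  halt k I := decide (1 ≤ k ∧ A < M.belief k I)
  measurable_take k := by
    refine measurable_to_bool ?_
    convert measurableSet_le (measurable_const (a := B)) (M.measurable_belief k) using 1
    ext I; simp
  measurable_halt k := by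
    refine measurable_to_bool ?_
    by_cases hk : 1 ≤ k
    · convert measurableSet_lt (measurable_const (a := A)) (M.measurable_belief k) using 1
      ext I; simp [hk]
    · convert MeasurableSet.empty using 1
      ext I; simp [hk]

/-- The belief `e^b / (1 + e^b)` that corresponds to `b ∈ [-∞, ∞)`; the value `⊥` is `b = -∞`. -/
noncomputable def ofLogit : WithBot ℝ → ℝ
  | ⊥ => 0
  | (b : ℝ) => Real.sigmoid b

/-- The two-threshold policy `γ(a, b)` with the thresholds on the scale `Z = log (p / (1 - p))`,
for `a ∈ ℝ` and `b ∈ [-∞, ∞)`. -/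
noncomputable def twoThreshold (a : ℝ) (b : WithBot ℝ) : Policy 𝒳 :=
  M.beliefThreshold (Real.sigmoid a) (ofLogit b)

end ChangeModel

end QCD

/-! ### Resampling one coordinate of a product measure. -/

namespace QCD

/-! Both the optimal delay and the delay of the two-threshold policies are `|log α| / rate` to first
order, with `rate = D(f₁, f₀) + |log (1 - ρ)|`. The divergence is what a fully observed post-change
sample contributes per step to the log posterior odds; the second term comes from the geometric
prior.

Lower bound (`eventually_le_ADD`): stopping within `N` steps of a change at `l` is compared with
stopping in the same window when the change is at `l + N`, which is a false alarm. The likelihood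
ratio of the `N` observations is at most about `exp (D N)` by the law of large numbers, and the
false alarm has probability at most `α / P(Γ > l + N)`, where the tail decays like `(1 - ρ) ^ N`.
For `N` slightly below `|log α| / rate` early stopping is therefore unlikely. The ratio is taken
over all observations, so the bound covers every sampling rule, and the ANO constraint plays no role
in it.

Upper bound (`exists_ADD_twoThreshold_le`): a nonnegative function of the odds, `lyap`, decreases on
average by at least `c < rate` in every step after the change, whether or not the observation is
taken. It starts at no more than `a + O(1)`, so the mean delay is at most `(a + O(1)) / c`. Its
`log` part handles steps with sampling; its `K / q` part pays for skipped steps, which occur only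
while the odds stay below `exp bmax`. Hence the ANO constraint costs a bounded amount only.

Feasibility: the odds exceed `exp a` on stopping, so PFA is at most `1 / (1 + exp a)`
(`PFA_twoThreshold_le`), which is `α` at `a = log ((1 - α) / α)`. PFA is positive, decreasing and
right-continuous in `a`, and ANO is increasing in `a`, which gives the smallest `a`. For the
existence of `b`, a high lower threshold postpones the first sample to a time that the change rarely
exceeds (`exists_forall_ANO_le`). -/

lemma measurable_update_pair {ι X : Type*} [DecidableEq ι] [MeasurableSpace X] (i : ι) :
    Measurable fun q : (ι → X) × X => Function.update q.1 i q.2 := by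
  refine measurable_pi_lambda _ fun j => ?_
  rcases eq_or_ne j i with rfl | h
  · simpa using measurable_snd
  · simp only [Function.update_of_ne h]; fun_prop

/-- Replacing one coordinate of a product measure by an independent variable of law `ν`. -/
lemma map_update_infinitePi {ι X : Type*} [DecidableEq ι] [MeasurableSpace X]
    (μ : ι → Measure X) [∀ i, IsProbabilityMeasure (μ i)] (i : ι) (ν : Measure X)
    [IsProbabilityMeasure ν] :
    ((Measure.infinitePi μ).prod ν).map (fun q : (ι → X) × X => Function.update q.1 i q.2)
      = Measure.infinitePi (Function.update μ i ν) := by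
  have hinst : ∀ j, IsProbabilityMeasure (Function.update μ i ν j) := by
    intro j
    rcases eq_or_ne j i with rfl | h
    · simpa
    · simpa [h] using inferInstanceAs (IsProbabilityMeasure (μ j))
  refine Measure.eq_infinitePi _ fun s t ht => ?_
  rw [Measure.map_apply (measurable_update_pair i)
    (MeasurableSet.pi s.countable_toSet fun j _ => ht j)]
  by_cases hi : i ∈ s
  · have hpre : (fun q : (ι → X) × X => Function.update q.1 i q.2) ⁻¹' (Set.pi s t)
        = (Set.pi (s.erase i : Finset ι) t) ×ˢ t i := by
      ext q
      simp only [Set.mem_preimage, Set.mem_pi, Finset.mem_coe, Set.mem_prod, Finset.mem_erase]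
      constructor
      · intro h
        refine ⟨fun j hj => ?_, by simpa using h i hi⟩
        simpa [hj.1] using h j hj.2
      · rintro ⟨h₁, h₂⟩ j hj
        rcases eq_or_ne j i with rfl | hji
        · simpa
        · simpa [hji] using h₁ j ⟨hji, hj⟩
    rw [hpre, Measure.prod_prod, Measure.infinitePi_pi _ (fun j _ => ht j),
      ← Finset.prod_erase_mul s _ hi]
    congr 1
    · refine Finset.prod_congr rfl fun j hj => ?_
      rw [Function.update_of_ne (Finset.ne_of_mem_erase hj)]
    · simp
  · have hpre : (fun q : (ι → X) × X => Function.update q.1 i q.2) ⁻¹' (Set.pi s t)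
        = (Set.pi s t) ×ˢ Set.univ := by
      ext q
      simp only [Set.mem_preimage, Set.mem_pi, Finset.mem_coe, Set.mem_prod, Set.mem_univ,
        and_true]
      refine forall₂_congr fun j hj => ?_
      rw [Function.update_of_ne (ne_of_mem_of_not_mem hj hi)]
    rw [hpre, Measure.prod_prod, Measure.infinitePi_pi _ (fun j _ => ht j), measure_univ, mul_one]
    refine Finset.prod_congr rfl fun j hj => ?_
    rw [Function.update_of_ne (ne_of_mem_of_not_mem hj hi)]

/-- Serves two purposes: with `ν = μ i` it integrates out one coordinate, in place of conditioning;
with another `ν` it moves the change point by one step. -/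
lemma lintegral_infinitePi_update {ι X : Type*} [DecidableEq ι] [MeasurableSpace X]
    (μ : ι → Measure X) [∀ i, IsProbabilityMeasure (μ i)] (i : ι) (ν : Measure X)
    [IsProbabilityMeasure ν] {F : (ι → X) → ℝ≥0∞} (hF : Measurable F) :
    ∫⁻ x, F x ∂Measure.infinitePi (Function.update μ i ν)
      = ∫⁻ x, ∫⁻ y, F (Function.update x i y) ∂ν ∂Measure.infinitePi μ := by
  rw [← map_update_infinitePi, lintegral_map hF (measurable_update_pair i),
    lintegral_prod (fun q : (ι → X) × X => F (Function.update q.1 i q.2))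
      (hF.comp (measurable_update_pair i)).aemeasurable]

/-! ### The prior, the likelihood ratio and changes of measure. -/

namespace ChangeModel

variable {𝒳 : Type*} [MeasurableSpace 𝒳] (M : ChangeModel 𝒳)

instance : IsProbabilityMeasure M.P₀ :=
  ⟨by rw [P₀, withDensity_apply _ MeasurableSet.univ, setLIntegral_univ, M.lintegral_f₀]⟩

instance : IsProbabilityMeasure M.P₁ :=
  ⟨by rw [P₁, withDensity_apply _ MeasurableSet.univ, setLIntegral_univ, M.lintegral_f₁]⟩

instance (p : Prop) [Decidable p] : IsProbabilityMeasure (if p then M.P₀ else M.P₁) := by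
  split_ifs <;> infer_instance

instance (l : ℕ) : IsProbabilityMeasure (M.pathLaw l) := by
  unfold pathLaw; infer_instance

lemma prior_nonneg (k : ℕ) : 0 ≤ M.prior k := by
  have := M.ρ_pos; have := M.ρ_lt_one; have := M.π₀_nonneg; have := M.π₀_lt_one
  unfold prior
  split_ifs
  · assumption
  · exact mul_nonneg (mul_nonneg (by linarith) (by linarith)) (pow_nonneg (by linarith) _)

/-- The tail `P(Γ > k)` of the prior. -/
noncomputable def tail (k : ℕ) : ℝ := (1 - M.π₀) * (1 - M.ρ) ^ k

lemma tail_pos (k : ℕ) : 0 < M.tail k :=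
  mul_pos (by linarith [M.π₀_lt_one]) (pow_pos (by linarith [M.ρ_lt_one]) _)

lemma tail_succ (k : ℕ) : M.tail (k + 1) = M.tail k * (1 - M.ρ) := by
  unfold tail; ring

lemma prior_succ (k : ℕ) : M.prior (k + 1) = M.ρ * M.tail k := by
  simp [prior, tail]; ring

lemma hasSum_prior_shift (n : ℕ) : HasSum (fun k => M.prior (n + 1 + k)) (M.tail n) := by
  have h := (hasSum_geometric_of_lt_one (r := 1 - M.ρ) (by linarith [M.ρ_lt_one])
    (by linarith [M.ρ_pos])).mul_left (M.ρ * M.tail n)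
  have hf : (fun k => M.prior (n + 1 + k)) = fun k => M.ρ * M.tail n * (1 - M.ρ) ^ k := by
    funext k
    rw [show n + 1 + k = n + k + 1 by ring, prior_succ, tail, tail, pow_add]; ring
  have hs : M.tail n = M.ρ * M.tail n * (1 - (1 - M.ρ))⁻¹ := by
    rw [sub_sub_cancel, mul_right_comm, mul_inv_cancel₀ M.ρ_pos.ne', one_mul]
  rw [← hs] at h
  rw [hf]
  exact h

lemma hasSum_prior : HasSum M.prior 1 := by
  have h := M.hasSum_prior_shift 0
  simp only [zero_add] at h
  refine (hasSum_nat_add_iff' (f := M.prior) (g := 1) 1).mp ?_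
  simpa [tail, prior, add_comm] using h

lemma tsum_ofReal_prior : ∑' l, ENNReal.ofReal (M.prior l) = 1 := by
  rw [← ENNReal.ofReal_tsum_of_nonneg M.prior_nonneg M.hasSum_prior.summable,
    M.hasSum_prior.tsum_eq, ENNReal.ofReal_one]

lemma tsum_ofReal_prior_shift (n : ℕ) :
    ∑' k, ENNReal.ofReal (M.prior (n + 1 + k)) = ENNReal.ofReal (M.tail n) := by
  rw [← ENNReal.ofReal_tsum_of_nonneg (fun _ => M.prior_nonneg _)
    (M.hasSum_prior_shift n).summable, (M.hasSum_prior_shift n).tsum_eq]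

lemma lintegral_law {F : ℕ × (ℕ → 𝒳) → ℝ≥0∞} (hF : Measurable F) :
    ∫⁻ ω, F ω ∂M.law
      = ∑' l, ENNReal.ofReal (M.prior l) * ∫⁻ x, F (l, x) ∂M.pathLaw l := by
  rw [law, lintegral_sum_measure]
  refine tsum_congr fun l => ?_
  rw [lintegral_smul_measure, Measure.dirac_prod, lintegral_map hF measurable_prodMk_left,
    smul_eq_mul]

lemma law_apply {s : Set (ℕ × (ℕ → 𝒳))} (hs : MeasurableSet s) :
    M.law s = ∑' l, ENNReal.ofReal (M.prior l) * M.pathLaw l {x | (l, x) ∈ s} := by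
  rw [← lintegral_indicator_one hs, M.lintegral_law (measurable_one.indicator hs)]
  refine tsum_congr fun l => ?_
  congr 1
  exact lintegral_indicator_one (measurable_prodMk_left hs)

/-- The law of the observation number `k` given `Γ = l`. -/
noncomputable def coordLaw (l k : ℕ) : Measure 𝒳 := if k < l then M.P₀ else M.P₁

instance (l k : ℕ) : IsProbabilityMeasure (M.coordLaw l k) := by
  unfold coordLaw; infer_instance

lemma lintegral_pathLaw_update (l k : ℕ) {F : (ℕ → 𝒳) → ℝ≥0∞} (hF : Measurable F) :
    ∫⁻ x, F x ∂M.pathLaw l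
      = ∫⁻ x, ∫⁻ y, F (Function.update x k y) ∂M.coordLaw l k ∂M.pathLaw l := by
  have h := lintegral_infinitePi_update (M.coordLaw l) k (M.coordLaw l k) hF
  rwa [Function.update_eq_self] at h

lemma coordLaw_succ (l : ℕ) :
    Function.update (M.coordLaw (l + 1)) l M.P₁ = M.coordLaw l := by
  funext k
  rcases eq_or_ne k l with rfl | h
  · simp [coordLaw]
  · rw [Function.update_of_ne h, coordLaw, coordLaw]
    have : k < l + 1 ↔ k < l := by omega
    simp [this]

lemma measurable_L : Measurable M.L := M.measurable_f₁.div M.measurable_f₀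

lemma L_nonneg (x : 𝒳) : 0 ≤ M.L x := div_nonneg (M.f₁_nonneg x) (M.f₀_nonneg x)

/-- The quotient `f₁ / f₀` is `0` in Lean where `f₀ = 0`; absolute continuity makes `f₁` vanish
there almost everywhere, so no mass is lost. -/
lemma P₁_eq_withDensity (hac : M.P₁ ≪ M.P₀) :
    M.P₁ = M.P₀.withDensity fun x => ENNReal.ofReal (M.L x) := by
  have hz : M.P₀ {x | M.f₀ x = 0} = 0 := by
    have hs : MeasurableSet {x | M.f₀ x = 0} := M.measurable_f₀ (measurableSet_singleton 0)
    rw [P₀, withDensity_apply _ hs, setLIntegral_eq_zero hs]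
    intro x hx
    have h : M.f₀ x = 0 := hx
    simp [h]
  have hz₁ := hac hz
  have hae : ∀ᵐ x ∂M.ref, M.f₀ x = 0 → ENNReal.ofReal (M.f₁ x) = 0 := by
    have hs : MeasurableSet {x | M.f₀ x = 0} := M.measurable_f₀ (measurableSet_singleton 0)
    rw [P₁, withDensity_apply _ hs,
      setLIntegral_eq_zero_iff hs M.measurable_f₁.ennreal_ofReal] at hz₁
    exact hz₁
  rw [P₁, P₀, ← withDensity_mul _ M.measurable_f₀.ennreal_ofReal M.measurable_L.ennreal_ofReal]
  refine withDensity_congr_ae ?_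
  filter_upwards [hae] with x hx
  rw [Pi.mul_apply, ← ENNReal.ofReal_mul (M.f₀_nonneg x)]
  rcases eq_or_ne (M.f₀ x) 0 with h | h
  · simp [h, hx h]
  · rw [L, mul_div_cancel₀ _ h]

lemma lintegral_P₁ (hac : M.P₁ ≪ M.P₀) {F : 𝒳 → ℝ≥0∞} (hF : Measurable F) :
    ∫⁻ x, F x ∂M.P₁ = ∫⁻ x, ENNReal.ofReal (M.L x) * F x ∂M.P₀ := by
  rw [M.P₁_eq_withDensity hac, lintegral_withDensity_eq_lintegral_mul _
    M.measurable_L.ennreal_ofReal hF]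
  rfl

lemma L_pos_ae (hac : M.P₁ ≪ M.P₀) : ∀ᵐ x ∂M.P₁, 0 < M.L x := by
  have hs : MeasurableSet {x | ¬ 0 < M.L x} :=
    (measurableSet_lt measurable_const M.measurable_L).compl
  rw [ae_iff, M.P₁_eq_withDensity hac, withDensity_apply _ hs, setLIntegral_eq_zero hs]
  intro x hx
  exact ENNReal.ofReal_of_nonpos (not_lt.mp hx)

/-- The integral equals `P₀ (L > 0)`. This makes the reciprocal odds a supermartingale after the
change, as the `K / q` term of `lyap` needs. -/
lemma lintegral_inv_L_le (hac : M.P₁ ≪ M.P₀) :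
    ∫⁻ x, ENNReal.ofReal (M.L x)⁻¹ ∂M.P₁ ≤ 1 := by
  rw [M.lintegral_P₁ hac (F := fun x => ENNReal.ofReal (M.L x)⁻¹)
    M.measurable_L.inv.ennreal_ofReal]
  calc ∫⁻ x, ENNReal.ofReal (M.L x) * ENNReal.ofReal (M.L x)⁻¹ ∂M.P₀
      ≤ ∫⁻ _, 1 ∂M.P₀ := by
        refine lintegral_mono fun x => ?_
        rw [← ENNReal.ofReal_mul (M.L_nonneg x)]
        exact ENNReal.ofReal_le_one.mpr (mul_inv_le_one)
    _ = 1 := by simp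

lemma integrable_inv_L (hac : M.P₁ ≪ M.P₀) : Integrable (fun x => (M.L x)⁻¹) M.P₁ := by
  refine ⟨M.measurable_L.inv.aestronglyMeasurable, ?_⟩
  rw [hasFiniteIntegral_iff_ofReal (ae_of_all _ fun x => inv_nonneg.mpr (M.L_nonneg x))]
  exact (M.lintegral_inv_L_le hac).trans_lt ENNReal.one_lt_top

lemma integral_inv_L_le (hac : M.P₁ ≪ M.P₀) : ∫ x, (M.L x)⁻¹ ∂M.P₁ ≤ 1 := by
  have h := M.lintegral_inv_L_le hac
  rw [← ofReal_integral_eq_lintegral_ofReal (M.integrable_inv_L hac)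
    (ae_of_all _ fun x => inv_nonneg.mpr (M.L_nonneg x))] at h
  exact ENNReal.ofReal_le_one.mp h

lemma integrable_log_L (hKL : InformationTheory.klDiv M.P₁ M.P₀ ≠ ∞) :
    Integrable (fun x => Real.log (M.L x)) M.P₁ := by
  obtain ⟨hac, hint⟩ := InformationTheory.klDiv_ne_top_iff.mp hKL
  refine hint.congr ?_
  have h : M.P₁.rnDeriv M.P₀ =ᵐ[M.P₀] fun x => ENNReal.ofReal (M.L x) := by
    conv_lhs => rw [M.P₁_eq_withDensity hac]
    exact Measure.rnDeriv_withDensity _ M.measurable_L.ennreal_ofReal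
  filter_upwards [hac.ae_le h] with x hx
  rw [llr, hx, ENNReal.toReal_ofReal (M.L_nonneg x)]

/-- The Kullback–Leibler divergence `D(f₁, f₀)`. -/
noncomputable def kl : ℝ := ∫ x, Real.log (M.L x) ∂M.P₁

/-- Integrate `log L ≥ 1 - 1 / L` and use that `1 / L` has mean at most one. -/
lemma kl_nonneg (hKL : InformationTheory.klDiv M.P₁ M.P₀ ≠ ∞) : 0 ≤ M.kl := by
  have hac := (InformationTheory.klDiv_ne_top_iff.mp hKL).1
  have h : ∫ x, (1 - (M.L x)⁻¹) ∂M.P₁ ≤ M.kl := by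
    refine integral_mono_ae ((integrable_const _).sub (M.integrable_inv_L hac))
      (M.integrable_log_L hKL) ?_
    filter_upwards [M.L_pos_ae hac] with x hx
    exact Real.one_sub_inv_le_log_of_pos hx
  rw [integral_sub (integrable_const _) (M.integrable_inv_L hac)] at h
  have := M.integral_inv_L_le hac
  simp at h
  linarith

/-- The change points `l` and `l + 1` give laws that differ only in coordinate `l`, so the density
is the single factor `L (x l)`. -/
lemma lintegral_pathLaw_succ (hac : M.P₁ ≪ M.P₀) (l : ℕ) {F : (ℕ → 𝒳) → ℝ≥0∞}
    (hF : Measurable F) :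
    ∫⁻ x, F x ∂M.pathLaw l = ∫⁻ x, ENNReal.ofReal (M.L (x l)) * F x ∂M.pathLaw (l + 1) := by
  have h := lintegral_infinitePi_update (M.coordLaw (l + 1)) l M.P₁ hF
  rw [M.coordLaw_succ] at h
  have hG : Measurable fun x : ℕ → 𝒳 => ENNReal.ofReal (M.L (x l)) * F x :=
    ((M.measurable_L.comp (measurable_pi_apply l)).ennreal_ofReal).mul hF
  rw [M.lintegral_pathLaw_update (l + 1) l hG]
  refine h.trans (lintegral_congr fun x => ?_)
  have hu : Measurable fun y => F (Function.update x l y) := hF.comp (measurable_update x)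
  rw [M.lintegral_P₁ hac hu]
  simp [coordLaw]

lemma lintegral_pathLaw_succ_of_update (l : ℕ) {F : (ℕ → 𝒳) → ℝ≥0∞}
    (hF : Measurable F) (hu : ∀ x y, F (Function.update x l y) = F x) :
    ∫⁻ x, F x ∂M.pathLaw l = ∫⁻ x, F x ∂M.pathLaw (l + 1) := by
  have h := lintegral_infinitePi_update (M.coordLaw (l + 1)) l M.P₁ hF
  rw [M.coordLaw_succ] at h
  exact h.trans (by simp [hu]; rfl)

/-- A functional of the first observations has the same law under all later change points. -/
lemma lintegral_pathLaw_eq {m n : ℕ} (hmn : m ≤ n) {F : (ℕ → 𝒳) → ℝ≥0∞}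
    (hF : Measurable F) (hu : ∀ j, m ≤ j → ∀ x y, F (Function.update x j y) = F x) :
    ∫⁻ x, F x ∂M.pathLaw m = ∫⁻ x, F x ∂M.pathLaw n := by
  induction n, hmn using Nat.le_induction with
  | base => rfl
  | succ n hmn ih => rw [ih, M.lintegral_pathLaw_succ_of_update n hF (hu n hmn)]

lemma pathLaw_apply_eq {m n : ℕ} (hmn : m ≤ n) {s : Set (ℕ → 𝒳)} (hs : MeasurableSet s)
    (hu : ∀ j, m ≤ j → ∀ x y, Function.update x j y ∈ s ↔ x ∈ s) :
    M.pathLaw m s = M.pathLaw n s := by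
  rw [← lintegral_indicator_one hs, ← lintegral_indicator_one hs]
  refine M.lintegral_pathLaw_eq hmn (measurable_one.indicator hs) fun j hj x y => ?_
  by_cases hx : x ∈ s
  · rw [Set.indicator_of_mem hx, Set.indicator_of_mem ((hu j hj x y).mpr hx), Pi.one_apply,
      Pi.one_apply]
  · rw [Set.indicator_of_notMem hx, Set.indicator_of_notMem ((hu j hj x y).not.mpr hx)]

/-- Change of measure from the change point `l` to the change point `l + n`. -/
lemma lintegral_pathLaw_add (hac : M.P₁ ≪ M.P₀) (l n : ℕ) {F : (ℕ → 𝒳) → ℝ≥0∞}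
    (hF : Measurable F) :
    ∫⁻ x, F x ∂M.pathLaw l
      = ∫⁻ x, ENNReal.ofReal (∏ i ∈ Finset.range n, M.L (x (l + i))) * F x
          ∂M.pathLaw (l + n) := by
  induction n with
  | zero => simp
  | succ n ih =>
    have hL : ∀ i, Measurable fun x : ℕ → 𝒳 => M.L (x i) :=
      fun i => M.measurable_L.comp (measurable_pi_apply i)
    rw [ih, M.lintegral_pathLaw_succ hac]
    · refine lintegral_congr fun x => ?_
      rw [Finset.prod_range_succ, mul_comm (∏ i ∈ _, _),
        ENNReal.ofReal_mul (M.L_nonneg _), mul_assoc]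
    · exact (Finset.measurable_prod _ fun i _ => hL _).ennreal_ofReal.mul hF

end ChangeModel

end QCD

/-! ### Information vectors, stopping times and the recursion for the odds. -/

namespace QCD

namespace Policy

variable {𝒳 : Type*} [MeasurableSpace 𝒳] (γ : Policy 𝒳)

lemma info_succ (x : ℕ → 𝒳) (k : ℕ) :
    γ.info x (k + 1) = Fin.snoc (α := fun _ => 𝒳 ⊕ Unit) (γ.info x k)
      (if γ.take k (γ.info x k) = true then Sum.inl (x (k + 1)) else Sum.inr ()) := rfl

lemma info_update {k j : ℕ} (hkj : k < j) (x : ℕ → 𝒳) (y : 𝒳) :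
    γ.info (Function.update x j y) k = γ.info x k := by
  induction k with
  | zero => rfl
  | succ k ih =>
    rw [info_succ, info_succ, ih (by omega), Function.update_of_ne (by omega)]

lemma info_eq_of_take_eq {γ γ' : Policy 𝒳} (h : γ.take = γ'.take) (x : ℕ → 𝒳) (k : ℕ) :
    γ.info x k = γ'.info x k := by
  induction k with
  | zero => rfl
  | succ k ih => rw [info_succ, info_succ, ih, h]

lemma measurable_snoc (k : ℕ) :
    Measurable fun q : (Fin k → 𝒳 ⊕ Unit) × (𝒳 ⊕ Unit) =>
      (Fin.snoc (α := fun _ => 𝒳 ⊕ Unit) q.1 q.2 : Fin (k + 1) → 𝒳 ⊕ Unit) := by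
  refine measurable_pi_lambda _ fun i => ?_
  refine Fin.lastCases ?_ (fun i => ?_) i
  · simpa using measurable_snd
  · simp only [Fin.snoc_castSucc]; fun_prop

lemma measurable_info (k : ℕ) : Measurable fun x : ℕ → 𝒳 => γ.info x k := by
  induction k with
  | zero => exact measurable_const
  | succ k ih =>
    have hset : MeasurableSet {x : ℕ → 𝒳 | γ.take k (γ.info x k) = true} :=
      ((γ.measurable_take k).comp ih) (measurableSet_singleton true)
    have hobs : Measurable fun x : ℕ → 𝒳 =>
        (if γ.take k (γ.info x k) = true then Sum.inl (x (k + 1)) else Sum.inr () : 𝒳 ⊕ Unit) :=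
      Measurable.ite hset (measurable_inl.comp (measurable_pi_apply _)) measurable_const
    exact (measurable_snoc k).comp (ih.prodMk hobs)

lemma measurableSet_take (k : ℕ) : MeasurableSet {x : ℕ → 𝒳 | γ.take k (γ.info x k) = true} :=
  ((γ.measurable_take k).comp (γ.measurable_info k)) (measurableSet_singleton true)

lemma measurableSet_halt (k : ℕ) : MeasurableSet {x : ℕ → 𝒳 | γ.halt k (γ.info x k) = true} :=
  ((γ.measurable_halt k).comp (γ.measurable_info k)) (measurableSet_singleton true)

lemma stopTime_lt_iff (x : ℕ → 𝒳) (n : ℕ) :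
    γ.stopTime x < (n : ℕ∞) ↔ ∃ k < n, γ.halt k (γ.info x k) = true := by
  simp only [stopTime, iInf_lt_iff, Nat.cast_lt]
  exact ⟨fun ⟨k, h, hk⟩ => ⟨k, hk, h⟩, fun ⟨k, hk, h⟩ => ⟨k, h, hk⟩⟩

lemma stopTime_lt_update {n j : ℕ} (hnj : n ≤ j) (x : ℕ → 𝒳) (y : 𝒳) :
    γ.stopTime (Function.update x j y) < (n : ℕ∞) ↔ γ.stopTime x < (n : ℕ∞) := by
  rw [stopTime_lt_iff, stopTime_lt_iff]
  refine exists_congr fun k => and_congr_right fun hk => ?_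
  rw [γ.info_update (by omega)]

lemma measurableSet_stopTime_lt (n : ℕ) :
    MeasurableSet {x : ℕ → 𝒳 | γ.stopTime x < (n : ℕ∞)} := by
  simp only [stopTime_lt_iff]
  have : {x : ℕ → 𝒳 | ∃ k < n, γ.halt k (γ.info x k) = true}
      = ⋃ k ∈ Finset.range n, {x | γ.halt k (γ.info x k) = true} := by
    ext x; simp
  rw [this]
  exact Finset.measurableSet_biUnion _ fun k _ => γ.measurableSet_halt k

lemma setOf_stopTime_lt_mono {m n : ℕ} (h : m ≤ n) :
    {x : ℕ → 𝒳 | γ.stopTime x < (m : ℕ∞)} ⊆ {x | γ.stopTime x < (n : ℕ∞)} := by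
  intro x hx
  change γ.stopTime x < (n : ℕ∞)
  exact lt_of_lt_of_le hx (Nat.cast_le.mpr h)

end Policy

/-- The delay counts the `k` with `l + k + 1 ≤ t`, also for `t = ⊤`; it turns ADD into a sum of
survival probabilities. -/
lemma coe_sub_eq_tsum (t : ℕ∞) (l : ℕ) :
    ((t - (l : ℕ∞) : ℕ∞) : ℝ≥0∞)
      = ∑' k : ℕ, if t < ((l + k + 1 : ℕ) : ℕ∞) then 0 else 1 := by
  induction t using ENat.recTopCoe with
  | top => simp
  | coe n =>
    rw [tsum_eq_sum (s := Finset.range (n - l))]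
    · rw [Finset.sum_congr rfl (g := fun _ => 1)]
      · rw [← ENat.natCast_sub]; simp
      · intro k hk
        rw [Finset.mem_range] at hk
        rw [if_neg]
        rw [Nat.cast_lt]; omega
    · intro k hk
      rw [Finset.mem_range] at hk
      rw [if_pos]
      rw [Nat.cast_lt]; omega

namespace ChangeModel

variable {𝒳 : Type*} [MeasurableSpace 𝒳] (M : ChangeModel 𝒳)

lemma ADD_eq (γ : Policy 𝒳) :
    M.ADD γ = ∑' l : ℕ, ENNReal.ofReal (M.prior l) *
      ∑' k : ℕ, M.pathLaw l {x | γ.stopTime x < ((l + k + 1 : ℕ) : ℕ∞)}ᶜ := by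
  classical
  have hm : ∀ l k : ℕ, Measurable fun x : ℕ → 𝒳 =>
      (if γ.stopTime x < ((l + k + 1 : ℕ) : ℕ∞) then 0 else 1 : ℝ≥0∞) := fun l k =>
    Measurable.ite (γ.measurableSet_stopTime_lt _) measurable_const measurable_const
  unfold ADD
  simp only [coe_sub_eq_tsum]
  rw [M.lintegral_law]
  · refine tsum_congr fun l => ?_
    congr 1
    rw [lintegral_tsum fun k => (hm l k).aemeasurable]
    refine tsum_congr fun k => ?_
    rw [← lintegral_indicator_one (γ.measurableSet_stopTime_lt _).compl]
    refine lintegral_congr fun x => ?_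
    by_cases h : γ.stopTime x < ((l + k + 1 : ℕ) : ℕ∞)
    · rw [if_pos h, Set.indicator_of_notMem (by simpa using h)]
    · rw [if_neg h, Set.indicator_of_mem (by simpa using h), Pi.one_apply]
  · refine measurable_from_prod_countable_right fun l => ?_
    exact Measurable.tsum fun k => hm l k

lemma measurableSet_falseAlarm (γ : Policy 𝒳) :
    MeasurableSet {ω : ℕ × (ℕ → 𝒳) | γ.stopTime ω.2 < (ω.1 : ℕ∞)} := by
  have : {ω : ℕ × (ℕ → 𝒳) | γ.stopTime ω.2 < (ω.1 : ℕ∞)}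
      = ⋃ l : ℕ, {l} ×ˢ {x | γ.stopTime x < (l : ℕ∞)} := by
    ext ⟨l, x⟩; simp
  rw [this]
  exact MeasurableSet.iUnion fun l =>
    (measurableSet_singleton l).prod (γ.measurableSet_stopTime_lt l)

lemma PFA_eq (γ : Policy 𝒳) :
    M.PFA γ = ∑' l : ℕ, ENNReal.ofReal (M.prior l) *
      M.pathLaw l {x | γ.stopTime x < (l : ℕ∞)} :=
  M.law_apply (measurableSet_falseAlarm γ)

open Classical in
lemma ANO_eq (γ : Policy 𝒳) :
    M.ANO γ = ∑' l : ℕ, ENNReal.ofReal (M.prior l) *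
      ∫⁻ x, ∑ k ∈ Finset.Icc 1 (l - 1),
        (if (k : ℕ∞) ≤ γ.stopTime x ∧ γ.Samples x k then (1 : ℝ≥0∞) else 0) ∂M.pathLaw l := by
  have h : ∀ k : ℕ, Measurable fun x : ℕ → 𝒳 =>
      (if (k : ℕ∞) ≤ γ.stopTime x ∧ γ.Samples x k then (1 : ℝ≥0∞) else 0) := by
    intro k
    have hset : {x : ℕ → 𝒳 | (k : ℕ∞) ≤ γ.stopTime x} = {x | γ.stopTime x < (k : ℕ∞)}ᶜ := by
      ext x; simp
    have hm : MeasurableSet {x : ℕ → 𝒳 | (k : ℕ∞) ≤ γ.stopTime x} := by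
      rw [hset]; exact (γ.measurableSet_stopTime_lt k).compl
    exact Measurable.ite (hm.inter (γ.measurableSet_take _)) measurable_const measurable_const
  exact M.lintegral_law (measurable_from_prod_countable_right fun l =>
    Finset.measurable_fun_sum (Finset.Icc 1 (l - 1)) fun k _ => h k)

lemma Φ₀_lt_one {p : ℝ} (h : p < 1) : M.Φ₀ p < 1 := by
  have := M.ρ_lt_one
  unfold Φ₀; nlinarith

lemma Φ₀_nonneg {p : ℝ} (h₀ : 0 ≤ p) (h : p < 1) : 0 ≤ M.Φ₀ p := by
  have := M.ρ_pos
  unfold Φ₀; nlinarith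

lemma Φ₁_nonneg (x : 𝒳) {p : ℝ} (h₀ : 0 ≤ p) (h : p < 1) : 0 ≤ M.Φ₁ x p := by
  have h₁ := M.Φ₀_nonneg h₀ h
  have h₂ := M.Φ₀_lt_one h
  have h₃ := mul_nonneg h₁ (M.L_nonneg x)
  exact div_nonneg h₃ (by linarith)

lemma Φ₁_lt_one (x : 𝒳) {p : ℝ} (h₀ : 0 ≤ p) (h : p < 1) : M.Φ₁ x p < 1 := by
  have h₁ := M.Φ₀_nonneg h₀ h
  have h₂ := M.Φ₀_lt_one h
  have h₃ := mul_nonneg h₁ (M.L_nonneg x)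
  exact (div_lt_one (by linarith)).mpr (by linarith)

lemma belief_mem (k : ℕ) (I : Fin k → 𝒳 ⊕ Unit) : 0 ≤ M.belief k I ∧ M.belief k I < 1 := by
  induction k with
  | zero => exact ⟨M.π₀_nonneg, M.π₀_lt_one⟩
  | succ k ih =>
    obtain ⟨h₀, h₁⟩ := ih (Fin.init I)
    rw [belief]
    rcases I (Fin.last k) with x | _
    · exact ⟨M.Φ₁_nonneg x h₀ h₁, M.Φ₁_lt_one x h₀ h₁⟩
    · exact ⟨M.Φ₀_nonneg h₀ h₁, M.Φ₀_lt_one h₁⟩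

lemma belief_info_succ (γ : Policy 𝒳) (x : ℕ → 𝒳) (k : ℕ) :
    M.belief (k + 1) (γ.info x (k + 1))
      = if γ.take k (γ.info x k) = true then M.Φ₁ (x (k + 1)) (M.belief k (γ.info x k))
        else M.Φ₀ (M.belief k (γ.info x k)) := by
  rw [belief, γ.info_succ, Fin.init_snoc, Fin.snoc_last]
  split_ifs <;> rfl

/-- The posterior odds of `Γ ≤ k` after the observations up to time `k`. -/
noncomputable def odds (γ : Policy 𝒳) (k : ℕ) (x : ℕ → 𝒳) : ℝ :=
  M.belief k (γ.info x k) / (1 - M.belief k (γ.info x k))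

lemma odds_nonneg (γ : Policy 𝒳) (k : ℕ) (x : ℕ → 𝒳) : 0 ≤ M.odds γ k x := by
  obtain ⟨h₀, h₁⟩ := M.belief_mem k (γ.info x k)
  exact div_nonneg h₀ (by linarith)

lemma odds_zero (γ : Policy 𝒳) (x : ℕ → 𝒳) : M.odds γ 0 x = M.π₀ / (1 - M.π₀) := rfl

/-- On the odds scale the normalizing denominator of Bayes' rule cancels: a time step is affine and
an observation multiplies by `L`. -/
lemma odds_succ (γ : Policy 𝒳) (k : ℕ) (x : ℕ → 𝒳) :
    M.odds γ (k + 1) x = (M.odds γ k x + M.ρ) / (1 - M.ρ) *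
      (if γ.take k (γ.info x k) = true then M.L (x (k + 1)) else 1) := by
  unfold odds
  rw [M.belief_info_succ]
  obtain ⟨h₀, h₁⟩ := M.belief_mem k (γ.info x k)
  generalize M.belief k (γ.info x k) = p at *
  have hρ := M.ρ_lt_one
  have h₂ : (1 - p) ≠ 0 := by linarith
  have h₃ : (1 - M.ρ) ≠ 0 := by linarith
  split_ifs
  · have h₄ := M.Φ₀_nonneg h₀ h₁
    have h₅ := M.Φ₀_lt_one h₁
    have h₆ := mul_nonneg h₄ (M.L_nonneg (x (k + 1)))
    have h₇ : M.Φ₀ p * M.L (x (k + 1)) + (1 - M.Φ₀ p) ≠ 0 := by linarith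
    have h₈ : 1 - M.Φ₁ (x (k + 1)) p
        = (1 - M.Φ₀ p) / (M.Φ₀ p * M.L (x (k + 1)) + (1 - M.Φ₀ p)) := by
      unfold Φ₁; field_simp; ring
    rw [h₈, Φ₁, div_div_div_cancel_right₀ h₇]
    have h₉ : 1 - M.Φ₀ p = (1 - p) * (1 - M.ρ) := by unfold Φ₀; ring
    rw [h₉]
    unfold Φ₀
    field_simp
  · have h₉ : 1 - M.Φ₀ p = (1 - p) * (1 - M.ρ) := by unfold Φ₀; ring
    rw [h₉]
    unfold Φ₀
    field_simp

lemma odds_update (γ : Policy 𝒳) {k j : ℕ} (hkj : k < j) (x : ℕ → 𝒳) (y : 𝒳) :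
    M.odds γ k (Function.update x j y) = M.odds γ k x := by
  unfold odds; rw [γ.info_update hkj]

lemma measurable_odds (γ : Policy 𝒳) (k : ℕ) : Measurable (M.odds γ k) :=
  have h := (M.measurable_belief k).comp (γ.measurable_info k)
  h.div (measurable_const.sub h)

lemma sigmoid_lt_iff_lt_odds {p : ℝ} (hp : p < 1) (a : ℝ) :
    Real.sigmoid a < p ↔ Real.exp a < p / (1 - p) := by
  have he := Real.exp_pos a
  have h : Real.sigmoid a = Real.exp a / (1 + Real.exp a) := by
    rw [Real.sigmoid_def, Real.exp_neg]; field_simp; ring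
  rw [h, div_lt_iff₀ (by positivity), lt_div_iff₀ (by linarith)]
  constructor <;> intro h <;> nlinarith

lemma twoThreshold_halt (a : ℝ) (b : WithBot ℝ) (x : ℕ → 𝒳) (k : ℕ) :
    (M.twoThreshold a b).halt k ((M.twoThreshold a b).info x k) = true ↔
      1 ≤ k ∧ Real.exp a < M.odds (M.twoThreshold a b) k x := by
  rw [odds, ← sigmoid_lt_iff_lt_odds (M.belief_mem _ _).2]
  simp [twoThreshold, beliefThreshold]

lemma twoThreshold_take (a : ℝ) (b : WithBot ℝ) (k : ℕ) (I : Fin k → 𝒳 ⊕ Unit) :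
    (M.twoThreshold a b).take k I = true ↔ ofLogit b ≤ M.belief k I := by
  simp [twoThreshold, beliefThreshold]

lemma ofLogit_le_sigmoid {b : WithBot ℝ} {c : ℝ} (h : b ≤ (c : WithBot ℝ)) :
    ofLogit b ≤ Real.sigmoid c := by
  induction b using WithBot.recBotCoe with
  | bot => exact Real.sigmoid_nonneg c
  | coe b => exact Real.sigmoid_le (WithBot.coe_le_coe.mp h)

/-- The upper threshold only affects stopping, and `info` keeps evolving after the stopping time.
Policies with the same `b` thus run on the same odds process, which makes them comparable path by
path. -/
lemma twoThreshold_info (a a' : ℝ) (b : WithBot ℝ) (x : ℕ → 𝒳) (k : ℕ) :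
    (M.twoThreshold a b).info x k = (M.twoThreshold a' b).info x k :=
  Policy.info_eq_of_take_eq (γ := M.twoThreshold a b) (γ' := M.twoThreshold a' b) rfl x k

lemma twoThreshold_odds (a a' : ℝ) (b : WithBot ℝ) (x : ℕ → 𝒳) (k : ℕ) :
    M.odds (M.twoThreshold a b) k x = M.odds (M.twoThreshold a' b) k x := by
  unfold odds; rw [M.twoThreshold_info a a']

lemma twoThreshold_stopTime_lt_iff (a : ℝ) (b : WithBot ℝ) (x : ℕ → 𝒳) (n : ℕ) :
    (M.twoThreshold a b).stopTime x < (n : ℕ∞) ↔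
      ∃ k < n, 1 ≤ k ∧ Real.exp a < M.odds (M.twoThreshold a b) k x := by
  simp only [Policy.stopTime_lt_iff, twoThreshold_halt]

end ChangeModel

end QCD

/-! ### Posterior odds as a density, and bounds for the probability of false alarm. -/

namespace QCD

namespace Policy

variable {𝒳 : Type*} [MeasurableSpace 𝒳] (γ : Policy 𝒳)

lemma info_castLE {j k : ℕ} (hjk : j ≤ k) (x : ℕ → 𝒳) :
    γ.info x j = fun i => γ.info x k (Fin.castLE hjk i) := by
  induction k, hjk using Nat.le_induction with
  | base => rfl
  | succ k hjk ih =>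
    rw [ih]
    funext i
    have : Fin.castLE (Nat.le_succ_of_le hjk) i = (Fin.castLE hjk i).castSucc := rfl
    rw [info_succ, this, Fin.snoc_castSucc]

/-- The event `τ = k` as a set of information vectors `I_k`. -/
def stopInfo (k : ℕ) : Set (Fin k → 𝒳 ⊕ Unit) :=
  {I | γ.halt k I = true ∧ ∀ j : Fin k, ¬ γ.halt j (fun i => I (Fin.castLE j.is_lt.le i)) = true}

lemma measurableSet_stopInfo (k : ℕ) : MeasurableSet (γ.stopInfo k) := by
  refine ((γ.measurable_halt k) (measurableSet_singleton true)).inter ?_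
  have hset : {I : Fin k → 𝒳 ⊕ Unit |
        ∀ j : Fin k, ¬ γ.halt j (fun i => I (Fin.castLE j.is_lt.le i)) = true}
      = ⋂ j : Fin k, {I | γ.halt j (fun i => I (Fin.castLE j.is_lt.le i)) = true}ᶜ := by
    ext I; simp
  change MeasurableSet {I : Fin k → 𝒳 ⊕ Unit |
        ∀ j : Fin k, ¬ γ.halt j (fun i => I (Fin.castLE j.is_lt.le i)) = true}
  rw [hset]
  refine MeasurableSet.iInter fun j => MeasurableSet.compl ?_
  have hm : Measurable fun I : Fin k → 𝒳 ⊕ Unit =>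
      γ.halt j (fun i => I (Fin.castLE j.is_lt.le i)) :=
    (γ.measurable_halt j).comp (measurable_pi_lambda _ fun i => measurable_pi_apply _)
  exact hm (measurableSet_singleton true)

lemma info_mem_stopInfo (k : ℕ) (x : ℕ → 𝒳) :
    γ.info x k ∈ γ.stopInfo k ↔
      γ.halt k (γ.info x k) = true ∧ ∀ j < k, ¬ γ.halt j (γ.info x j) = true := by
  refine and_congr_right fun _ => ⟨fun h j hj => ?_, fun h j => ?_⟩
  · rw [γ.info_castLE hj.le]; exact h ⟨j, hj⟩
  · rw [← γ.info_castLE j.is_lt.le]; exact h j j.is_lt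

/-- The event `τ = k`. -/
def stopAt (k : ℕ) : Set (ℕ → 𝒳) := {x | γ.info x k ∈ γ.stopInfo k}

lemma measurableSet_stopAt (k : ℕ) : MeasurableSet (γ.stopAt k) :=
  (γ.measurable_info k) (γ.measurableSet_stopInfo k)

lemma pairwise_disjoint_stopAt : Pairwise (Function.onFun Disjoint γ.stopAt) := by
  have key : ∀ j k, j < k → Disjoint (γ.stopAt j) (γ.stopAt k) := by
    intro j k hjk
    refine Set.disjoint_left.mpr fun x hj hk => ?_
    exact ((γ.info_mem_stopInfo k x).mp hk).2 j hjk ((γ.info_mem_stopInfo j x).mp hj).1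
  intro j k hjk
  rcases lt_or_gt_of_ne hjk with h | h
  · exact key j k h
  · exact (key k j h).symm

lemma setOf_stopTime_lt (l : ℕ) :
    {x | γ.stopTime x < (l : ℕ∞)} = ⋃ k ∈ Finset.range l, γ.stopAt k := by
  classical
  ext x
  rw [Set.mem_iUnion₂]
  refine (γ.stopTime_lt_iff x l).trans ⟨fun h => ?_, fun ⟨k, hk, h⟩ => ?_⟩
  · have hex : ∃ k, γ.halt k (γ.info x k) = true := h.imp fun k hk => hk.2
    obtain ⟨k, hk, hk'⟩ := h
    refine ⟨Nat.find hex, Finset.mem_range.mpr ((Nat.find_min' hex hk').trans_lt hk), ?_⟩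
    exact (γ.info_mem_stopInfo _ x).mpr ⟨Nat.find_spec hex, fun j hj => Nat.find_min hex hj⟩
  · exact ⟨k, Finset.mem_range.mp hk, ((γ.info_mem_stopInfo k x).mp h).1⟩

end Policy

namespace ChangeModel

variable {𝒳 : Type*} [MeasurableSpace 𝒳] (M : ChangeModel 𝒳)

/-- The posterior odds are the density, on the information available at time `k`, of the change
having occurred relative to its not having occurred. -/
lemma sum_prior_mul_lintegral_info (hac : M.P₁ ≪ M.P₀) (γ : Policy 𝒳) (k : ℕ)
    {h : (Fin k → 𝒳 ⊕ Unit) → ℝ≥0∞} (hh : Measurable h) :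
    ∑ l ∈ Finset.range (k + 1), ENNReal.ofReal (M.prior l) * ∫⁻ x, h (γ.info x k) ∂M.pathLaw l
      = ENNReal.ofReal (M.tail k) *
        ∫⁻ x, h (γ.info x k) * ENNReal.ofReal (M.odds γ k x) ∂M.pathLaw (k + 1) := by
  classical
  induction k with
  | zero =>
    have h₁ : 1 - M.π₀ ≠ 0 := by linarith [M.π₀_lt_one]
    have hinfo : ∀ x : ℕ → 𝒳, γ.info x 0 = Fin.elim0 := fun _ => rfl
    simp only [hinfo, odds_zero, lintegral_const, measure_univ, mul_one, zero_add,
      Finset.range_one, Finset.sum_singleton]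
    rw [mul_left_comm, ← ENNReal.ofReal_mul (M.tail_pos 0).le, mul_comm (h _)]
    congr 2
    simp [prior, tail]
    field_simp
  | succ k ih =>
    have hρ := M.ρ_pos
    have hρ' : 0 < 1 - M.ρ := by linarith [M.ρ_lt_one]
    -- The mean of `h` given the information at time `k` when the next observation has the
    -- post-change law; the induction hypothesis is applied to it.
    set hn : (Fin k → 𝒳 ⊕ Unit) → ℝ≥0∞ := fun I =>
      if γ.take k I = true then
        ∫⁻ y, h (Fin.snoc (α := fun _ => 𝒳 ⊕ Unit) I (Sum.inl y)) ∂M.P₁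
      else h (Fin.snoc (α := fun _ => 𝒳 ⊕ Unit) I (Sum.inr ())) with hn_def
    have hsl : Measurable fun q : (Fin k → 𝒳 ⊕ Unit) × 𝒳 =>
        h (Fin.snoc (α := fun _ => 𝒳 ⊕ Unit) q.1 (Sum.inl q.2)) :=
      hh.comp ((Policy.measurable_snoc k).comp
        (measurable_fst.prodMk (measurable_inl.comp measurable_snd)))
    have hn_meas : Measurable hn := by
      refine Measurable.ite ((γ.measurable_take k) (measurableSet_singleton true)) ?_ ?_
      · exact hsl.lintegral_prod_right'
      · exact hh.comp ((Policy.measurable_snoc k).comp (measurable_id.prodMk measurable_const))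
    have hpost : ∀ l ∈ Finset.range (k + 1 + 1),
        ∫⁻ x, h (γ.info x (k + 1)) ∂M.pathLaw l = ∫⁻ x, hn (γ.info x k) ∂M.pathLaw l := by
      intro l hl
      rw [Finset.mem_range] at hl
      have hF : Measurable fun x : ℕ → 𝒳 => h (γ.info x (k + 1)) :=
        hh.comp (γ.measurable_info (k + 1))
      rw [M.lintegral_pathLaw_update l (k + 1) hF]
      refine lintegral_congr fun x => ?_
      have hc : M.coordLaw l (k + 1) = M.P₁ := if_neg (by omega)
      simp only [γ.info_succ, γ.info_update (Nat.lt_succ_self k), Function.update_self, hc, hn_def]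
      by_cases ht : γ.take k (γ.info x k) = true
      · simp [ht]
      · simp [ht]
    -- Here observation `k + 1` precedes the change; if it is taken, the factor `L` in the odds
    -- converts `P₀` into `P₁`, so the same `hn` appears.
    have hpre : ∫⁻ x, h (γ.info x (k + 1)) * ENNReal.ofReal (M.odds γ (k + 1) x)
          ∂M.pathLaw (k + 1 + 1)
        = ∫⁻ x, hn (γ.info x k) * ENNReal.ofReal ((M.odds γ k x + M.ρ) / (1 - M.ρ))
          ∂M.pathLaw (k + 1) := by
      have hF : Measurable fun x : ℕ → 𝒳 =>
          h (γ.info x (k + 1)) * ENNReal.ofReal (M.odds γ (k + 1) x) :=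
        (hh.comp (γ.measurable_info (k + 1))).mul (M.measurable_odds γ (k + 1)).ennreal_ofReal
      have hG : Measurable fun x : ℕ → 𝒳 =>
          hn (γ.info x k) * ENNReal.ofReal ((M.odds γ k x + M.ρ) / (1 - M.ρ)) :=
        (hn_meas.comp (γ.measurable_info k)).mul
          (((M.measurable_odds γ k).add_const _).div_const _).ennreal_ofReal
      rw [M.lintegral_pathLaw_succ_of_update (k + 1) hG (fun x y => by
          rw [γ.info_update (Nat.lt_succ_self k), M.odds_update γ (Nat.lt_succ_self k)]),
        M.lintegral_pathLaw_update (k + 1 + 1) (k + 1) hF]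
      refine lintegral_congr fun x => ?_
      have hc : M.coordLaw (k + 1 + 1) (k + 1) = M.P₀ := if_pos (by omega)
      have hq : 0 ≤ (M.odds γ k x + M.ρ) / (1 - M.ρ) :=
        div_nonneg (add_nonneg (M.odds_nonneg γ k x) hρ.le) hρ'.le
      simp only [γ.info_succ, M.odds_succ, γ.info_update (Nat.lt_succ_self k),
        M.odds_update γ (Nat.lt_succ_self k), Function.update_self, hc, hn_def]
      by_cases ht : γ.take k (γ.info x k) = true
      · have hsx : Measurable fun y : 𝒳 =>
            h (Fin.snoc (α := fun _ => 𝒳 ⊕ Unit) (γ.info x k) (Sum.inl y)) :=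
          hsl.comp measurable_prodMk_left
        simp only [ht, if_true]
        rw [M.lintegral_P₁ hac hsx, ← lintegral_mul_const' _ _ ENNReal.ofReal_ne_top]
        refine lintegral_congr fun y => ?_
        rw [ENNReal.ofReal_mul hq]
        ring
      · simp [ht]
    have hn_info : Measurable fun x : ℕ → 𝒳 => hn (γ.info x k) :=
      hn_meas.comp (γ.measurable_info k)
    rw [hpre, Finset.sum_congr rfl fun l hl => by rw [hpost l hl], Finset.sum_range_succ,
      ih hn_meas, prior_succ, mul_comm M.ρ, ENNReal.ofReal_mul (M.tail_pos k).le, mul_assoc,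
      ← mul_add, ← lintegral_const_mul _ hn_info,
      ← lintegral_add_right _ (hn_info.const_mul _), tail_succ,
      ENNReal.ofReal_mul (M.tail_pos k).le, mul_assoc]
    congr 1
    rw [← lintegral_const_mul' _ _ ENNReal.ofReal_ne_top]
    refine lintegral_congr fun x => ?_
    rw [mul_left_comm (ENNReal.ofReal (1 - M.ρ)), ← ENNReal.ofReal_mul hρ'.le,
      mul_div_cancel₀ _ hρ'.ne', ENNReal.ofReal_add (M.odds_nonneg γ k x) hρ.le]
    ring

lemma tsum_prior_eq_add (k : ℕ) (f : ℕ → ℝ≥0∞) :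
    ∑' l, ENNReal.ofReal (M.prior l) * f l
      = ∑ l ∈ Finset.range (k + 1), ENNReal.ofReal (M.prior l) * f l
        + ∑' j, ENNReal.ofReal (M.prior (k + 1 + j)) * f (k + 1 + j) := by
  rw [← ENNReal.summable.sum_add_tsum_nat_add' (k := k + 1)]
  simp only [add_comm]

lemma pathLaw_stopAt (γ : Policy 𝒳) {k l : ℕ} (hkl : k < l) :
    M.pathLaw l (γ.stopAt k) = M.pathLaw (k + 1) (γ.stopAt k) := by
  refine (M.pathLaw_apply_eq (Nat.succ_le_of_lt hkl) (γ.measurableSet_stopAt k)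
    fun j hj x y => ?_).symm
  change γ.info (Function.update x j y) k ∈ γ.stopInfo k ↔ _
  rw [γ.info_update (Nat.lt_of_succ_le hj)]
  rfl

lemma tsum_prior_stopAt (γ : Policy 𝒳) (k : ℕ) :
    ∑' j, ENNReal.ofReal (M.prior (k + 1 + j)) * M.pathLaw (k + 1 + j) (γ.stopAt k)
      = ENNReal.ofReal (M.tail k) * M.pathLaw (k + 1) (γ.stopAt k) := by
  rw [← tsum_ofReal_prior_shift, ← ENNReal.tsum_mul_right]
  refine tsum_congr fun j => ?_
  rw [M.pathLaw_stopAt γ (by omega)]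

lemma PFA_eq_tsum_stopAt (γ : Policy 𝒳) :
    M.PFA γ = ∑' k, ENNReal.ofReal (M.tail k) * M.pathLaw (k + 1) (γ.stopAt k) := by
  classical
  have h : ∀ l, M.pathLaw l {x | γ.stopTime x < (l : ℕ∞)}
      = ∑' k, if k < l then M.pathLaw l (γ.stopAt k) else 0 := by
    intro l
    rw [γ.setOf_stopTime_lt, measure_biUnion_finset
      (fun i _ j _ hij => γ.pairwise_disjoint_stopAt hij) fun k _ => γ.measurableSet_stopAt k,
      tsum_eq_sum (s := Finset.range l)]
    · exact Finset.sum_congr rfl fun k hk => (if_pos (Finset.mem_range.mp hk)).symm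
    · exact fun k hk => if_neg fun h => hk (Finset.mem_range.mpr h)
  rw [M.PFA_eq]
  simp only [h, ← ENNReal.tsum_mul_left]
  rw [ENNReal.tsum_comm]
  refine tsum_congr fun k => ?_
  rw [M.tsum_prior_eq_add k, ← M.tsum_prior_stopAt γ k, Finset.sum_eq_zero, zero_add]
  · exact tsum_congr fun j => by rw [if_pos (by omega)]
  · intro l hl
    rw [if_neg (by rw [Finset.mem_range] at hl; omega), mul_zero]

/-- On `τ = k` the odds exceed `exp a`, so `P(τ = k, Γ ≤ k) ≥ exp a * P(τ = k, Γ > k)`. Adding `P(τ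
= k, Γ > k)` and summing over `k` leaves at most total mass one. -/
lemma PFA_twoThreshold_mul_le (hac : M.P₁ ≪ M.P₀) (a : ℝ) (b : WithBot ℝ) :
    M.PFA (M.twoThreshold a b) * ENNReal.ofReal (1 + Real.exp a) ≤ 1 := by
  classical
  set γ := M.twoThreshold a b with hγ
  have htot : ∑' k, ∑' l, ENNReal.ofReal (M.prior l) * M.pathLaw l (γ.stopAt k) ≤ 1 := by
    rw [ENNReal.tsum_comm, ← M.tsum_ofReal_prior]
    refine ENNReal.tsum_le_tsum fun l => ?_
    rw [ENNReal.tsum_mul_left, ← measure_iUnion γ.pairwise_disjoint_stopAt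
      γ.measurableSet_stopAt]
    exact mul_le_of_le_one_right' prob_le_one
  refine le_trans ?_ htot
  rw [M.PFA_eq_tsum_stopAt, ← ENNReal.tsum_mul_right]
  refine ENNReal.tsum_le_tsum fun k => ?_
  rw [M.tsum_prior_eq_add k, M.tsum_prior_stopAt, add_comm 1,
    ENNReal.ofReal_add (Real.exp_pos a).le zero_le_one, ENNReal.ofReal_one, mul_add, mul_one]
  gcongr
  have hm := γ.measurableSet_stopInfo k
  have hmx := γ.measurableSet_stopAt k
  have hind : ∀ (l : ℕ), M.pathLaw l (γ.stopAt k)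
      = ∫⁻ x, (γ.stopInfo k).indicator 1 (γ.info x k) ∂M.pathLaw l :=
    fun l => (lintegral_indicator_one hmx).symm
  rw [Finset.sum_congr rfl fun l _ => by rw [hind l],
    M.sum_prior_mul_lintegral_info hac γ k (measurable_one.indicator hm), mul_assoc]
  gcongr
  rw [hind, ← lintegral_mul_const' _ _ ENNReal.ofReal_ne_top]
  refine lintegral_mono fun x => ?_
  by_cases hx : γ.info x k ∈ γ.stopInfo k
  · rw [Set.indicator_of_mem hx]
    have h := ((M.twoThreshold_halt a b x k).mp ((γ.info_mem_stopInfo k x).mp hx).1).2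
    gcongr
  · rw [Set.indicator_of_notMem hx, zero_mul]
    exact zero_le

lemma PFA_twoThreshold_le (hac : M.P₁ ≪ M.P₀) (a : ℝ) (b : WithBot ℝ) :
    M.PFA (M.twoThreshold a b) ≤ ENNReal.ofReal (1 + Real.exp a)⁻¹ := by
  have hpos : 0 < 1 + Real.exp a := by positivity
  rw [ENNReal.ofReal_inv_of_pos hpos, ENNReal.le_inv_iff_mul_le]
  exact M.PFA_twoThreshold_mul_le hac a b

lemma tendsto_tail : Tendsto M.tail atTop (𝓝 0) := by
  have h := (tendsto_pow_atTop_nhds_zero_of_lt_one (r := 1 - M.ρ) (by linarith [M.ρ_lt_one])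
    (by linarith [M.ρ_pos])).const_mul (1 - M.π₀)
  rw [mul_zero] at h
  exact h

/-- Without false alarms the odds would stay below `exp a` almost surely before the change. Total
mass one would then be at most `P(Γ > k) * (1 + exp a)` for every `k ≥ 1`, which tends to zero. -/
lemma PFA_twoThreshold_pos (hac : M.P₁ ≪ M.P₀) (a : ℝ) (b : WithBot ℝ) :
    0 < M.PFA (M.twoThreshold a b) := by
  rw [pos_iff_ne_zero]
  intro h₀
  set γ := M.twoThreshold a b with hγ
  rw [M.PFA_eq, ENNReal.tsum_eq_zero] at h₀
  have key : ∀ k : ℕ, 1 ≤ k → 1 ≤ M.tail k * (1 + Real.exp a) := by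
    intro k hk
    have hprior : ENNReal.ofReal (M.prior (k + 1)) ≠ 0 := by
      rw [prior_succ]
      exact (ENNReal.ofReal_pos.mpr (mul_pos M.ρ_pos (M.tail_pos k))).ne'
    have hnull := (mul_eq_zero.mp (h₀ (k + 1))).resolve_left hprior
    have hle : ∀ᵐ x ∂M.pathLaw (k + 1), M.odds γ k x ≤ Real.exp a := by
      refine measure_mono_null (fun x hx => ?_) hnull
      exact (M.twoThreshold_stopTime_lt_iff a b x (k + 1)).mpr
        ⟨k, Nat.lt_succ_self k, hk, not_le.mp hx⟩
    have hid := M.sum_prior_mul_lintegral_info hac γ k (h := fun _ => 1) measurable_const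
    have hsplit := M.tsum_prior_eq_add k fun _ => 1
    simp only [mul_one, lintegral_const, measure_univ, one_mul, tsum_ofReal_prior,
      tsum_ofReal_prior_shift] at hid hsplit
    have hint : ∫⁻ x, ENNReal.ofReal (M.odds γ k x) ∂M.pathLaw (k + 1)
        ≤ ENNReal.ofReal (Real.exp a) := by
      calc _ ≤ ∫⁻ _, ENNReal.ofReal (Real.exp a) ∂M.pathLaw (k + 1) :=
            lintegral_mono_ae (hle.mono fun x hx => ENNReal.ofReal_le_ofReal hx)
        _ = _ := by simp
    have h₁ : (1 : ℝ≥0∞) ≤ ENNReal.ofReal (M.tail k * (1 + Real.exp a)) := by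
      rw [hsplit, hid, mul_add, mul_one, add_comm (M.tail k),
        ENNReal.ofReal_add (mul_nonneg (M.tail_pos k).le (Real.exp_pos a).le) (M.tail_pos k).le,
        ENNReal.ofReal_mul (M.tail_pos k).le]
      gcongr
    exact ENNReal.one_le_ofReal.mp h₁
  have hlim := M.tendsto_tail.mul_const (1 + Real.exp a)
  rw [zero_mul] at hlim
  have := ge_of_tendsto hlim (eventually_atTop.mpr ⟨1, key⟩)
  linarith

end ChangeModel

end QCD

/-! ### The ANO constraint and the choice of the thresholds. -/

namespace QCD
namespace ChangeModel

variable {𝒳 : Type*} [MeasurableSpace 𝒳] (M : ChangeModel 𝒳)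

lemma iterate_Φ₀_lt_one (k : ℕ) : M.Φ₀^[k] M.π₀ < 1 := by
  induction k with
  | zero => exact M.π₀_lt_one
  | succ k ih => rw [Function.iterate_succ_apply']; exact M.Φ₀_lt_one ih

/-- As long as the lower threshold exceeds the belief of a policy that never samples, no
observation is taken. -/
lemma twoThreshold_take_eq_false {a : ℝ} {b : WithBot ℝ} {n : ℕ}
    (hb : ∀ k < n, M.Φ₀^[k] M.π₀ < ofLogit b) (x : ℕ → 𝒳) {k : ℕ} (hk : k < n) :
    ¬ (M.twoThreshold a b).take k ((M.twoThreshold a b).info x k) = true := by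
  have h : M.belief k ((M.twoThreshold a b).info x k) = M.Φ₀^[k] M.π₀ := by
    induction k with
    | zero => rfl
    | succ k ih =>
      have ih' := ih (by omega)
      have ht : ¬ (M.twoThreshold a b).take k ((M.twoThreshold a b).info x k) = true := by
        rw [twoThreshold_take, ih', not_le]
        exact hb k (by omega)
      rw [belief_info_succ, if_neg ht, ih', Function.iterate_succ_apply']
  rw [twoThreshold_take, h, not_le]
  exact hb k hk

lemma summable_prior_mul : Summable fun l : ℕ => M.prior l * l := by
  have hr : ‖1 - M.ρ‖ < 1 := by
    rw [Real.norm_eq_abs, abs_lt]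
    constructor <;> linarith [M.ρ_pos, M.ρ_lt_one]
  have h := ((summable_pow_mul_geometric_of_norm_lt_one 1 hr).add
    (summable_geometric_of_norm_lt_one hr)).mul_left (M.ρ * (1 - M.π₀))
  refine (summable_nat_add_iff 1).mp (h.congr fun k => ?_)
  rw [prior_succ, tail]
  push_cast
  ring

/-- No sample is taken up to time `n`, so only `Γ > n` contributes, with at most `Γ` samples: the
bound is `E[Γ; Γ > n]`. -/
lemma ANO_twoThreshold_le {a : ℝ} {b : WithBot ℝ} {n : ℕ}
    (hb : ∀ k < n, M.Φ₀^[k] M.π₀ < ofLogit b) :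
    M.ANO (M.twoThreshold a b)
      ≤ ∑' j : ℕ, ENNReal.ofReal (M.prior (j + (n + 1)) * (j + (n + 1) : ℕ)) := by
  classical
  have hzero : ∑ l ∈ Finset.range (n + 1), ENNReal.ofReal (M.prior l) *
      ∫⁻ x, ∑ k ∈ Finset.Icc 1 (l - 1), (if (k : ℕ∞) ≤ (M.twoThreshold a b).stopTime x ∧
        (M.twoThreshold a b).Samples x k then (1 : ℝ≥0∞) else 0) ∂M.pathLaw l = 0 := by
    refine Finset.sum_eq_zero fun l hl => ?_
    rw [Finset.mem_range] at hl
    rw [lintegral_congr (g := fun _ => 0) fun x => Finset.sum_eq_zero fun k hk => ?_]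
    · simp
    · rw [Finset.mem_Icc] at hk
      exact if_neg fun h => M.twoThreshold_take_eq_false hb x (by omega) h.2
  rw [M.ANO_eq, M.tsum_prior_eq_add n, hzero, zero_add]
  refine ENNReal.tsum_le_tsum fun j => ?_
  rw [add_comm j, ENNReal.ofReal_mul (M.prior_nonneg _), ENNReal.ofReal_natCast]
  gcongr
  calc _ ≤ ∫⁻ _, ((n + 1 + j : ℕ) : ℝ≥0∞) ∂M.pathLaw (n + 1 + j) := by
        refine lintegral_mono fun x => ?_
        refine (Finset.sum_le_card_nsmul _ _ 1 fun k _ => ?_).trans ?_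
        · split_ifs <;> simp
        · rw [nsmul_eq_mul, mul_one, Nat.card_Icc]
          exact_mod_cast (by omega)
    _ = _ := by simp

lemma exists_forall_ANO_le {β : ℝ} (hβ : 0 < β) :
    ∃ b : WithBot ℝ, ∀ a : ℝ, M.ANO (M.twoThreshold a b) ≤ ENNReal.ofReal β := by
  have hsum : ∑' l : ℕ, ENNReal.ofReal (M.prior l * l) ≠ ∞ := by
    rw [← ENNReal.ofReal_tsum_of_nonneg
      (fun l => mul_nonneg (M.prior_nonneg l) l.cast_nonneg) M.summable_prior_mul]
    exact ENNReal.ofReal_ne_top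
  have hlim := (ENNReal.tendsto_sum_nat_add _ hsum).comp (tendsto_add_atTop_nat 1)
  obtain ⟨n, hn⟩ := (hlim.eventually (gt_mem_nhds (ENNReal.ofReal_pos.mpr hβ))).exists
  have hb : ∀ᶠ b in atTop, ∀ k ∈ Finset.range n, M.Φ₀^[k] M.π₀ < Real.sigmoid b :=
    (Finset.eventually_all _).mpr fun k _ =>
      Real.tendsto_sigmoid_atTop.eventually (lt_mem_nhds (M.iterate_Φ₀_lt_one k))
  obtain ⟨b, hb⟩ := hb.exists
  refine ⟨(b : WithBot ℝ), fun a => (M.ANO_twoThreshold_le (n := n) fun k hk => ?_).trans hn.le⟩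
  exact hb k (Finset.mem_range.mpr hk)

lemma twoThreshold_stopTime_lt_mono {a a' : ℝ} (h : a ≤ a') (b : WithBot ℝ) (x : ℕ → 𝒳) (n : ℕ) :
    (M.twoThreshold a' b).stopTime x < (n : ℕ∞) → (M.twoThreshold a b).stopTime x < (n : ℕ∞) := by
  rw [twoThreshold_stopTime_lt_iff, twoThreshold_stopTime_lt_iff]
  rintro ⟨k, hk, hk₁, hlt⟩
  refine ⟨k, hk, hk₁, ?_⟩
  rw [M.twoThreshold_odds a a']
  exact (Real.exp_le_exp.mpr h).trans_lt hlt

lemma PFA_twoThreshold_anti (b : WithBot ℝ) :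
    Antitone fun a : ℝ => M.PFA (M.twoThreshold a b) := by
  intro a a' h
  exact measure_mono fun ω hω => M.twoThreshold_stopTime_lt_mono h b ω.2 ω.1 hω

lemma ANO_twoThreshold_mono (b : WithBot ℝ) :
    Monotone fun a : ℝ => M.ANO (M.twoThreshold a b) := by
  classical
  intro a a' h
  refine lintegral_mono fun ω => Finset.sum_le_sum fun k _ => ?_
  by_cases hk : (k : ℕ∞) ≤ (M.twoThreshold a b).stopTime ω.2 ∧
      (M.twoThreshold a b).Samples ω.2 k
  · rw [if_pos hk, if_pos]
    refine ⟨?_, ?_⟩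
    · exact not_lt.mp fun hlt => not_lt.mpr hk.1 (M.twoThreshold_stopTime_lt_mono h b ω.2 k hlt)
    · have := hk.2
      rw [Policy.Samples, M.twoThreshold_info a a'] at this
      exact this
  · rw [if_neg hk]; exact zero_le

/-- The probability of false alarm is right-continuous in the upper threshold. -/
lemma PFA_twoThreshold_le_of_forall_gt {a : ℝ} {b : WithBot ℝ} {c : ℝ≥0∞}
    (h : ∀ a' > a, M.PFA (M.twoThreshold a' b) ≤ c) : M.PFA (M.twoThreshold a b) ≤ c := by
  set s : ℕ → Set (ℕ × (ℕ → 𝒳)) := fun n =>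
    {ω | (M.twoThreshold (a + 1 / ((n : ℝ) + 1)) b).stopTime ω.2 < (ω.1 : ℕ∞)} with hs
  have hmono : Monotone s := by
    intro m n hmn ω hω
    refine M.twoThreshold_stopTime_lt_mono ?_ b ω.2 ω.1 hω
    gcongr
  have hunion : {ω : ℕ × (ℕ → 𝒳) | (M.twoThreshold a b).stopTime ω.2 < (ω.1 : ℕ∞)} ⊆ ⋃ n, s n := by
    intro ω hω
    obtain ⟨k, hk, hk₁, hlt⟩ := (M.twoThreshold_stopTime_lt_iff a b ω.2 ω.1).mp hω
    have hlim : Tendsto (fun n : ℕ => Real.exp (a + 1 / ((n : ℝ) + 1))) atTop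
        (𝓝 (Real.exp a)) := by
      have := (tendsto_one_div_add_atTop_nhds_zero_nat (𝕜 := ℝ)).const_add a
      rw [add_zero] at this
      exact (Real.continuous_exp.tendsto a).comp this
    obtain ⟨n, hn⟩ := (hlim.eventually (gt_mem_nhds hlt)).exists
    refine Set.mem_iUnion.mpr ⟨n, (M.twoThreshold_stopTime_lt_iff _ b ω.2 ω.1).mpr
      ⟨k, hk, hk₁, ?_⟩⟩
    rwa [M.twoThreshold_odds _ a]
  calc M.PFA (M.twoThreshold a b) ≤ M.law (⋃ n, s n) := measure_mono hunion
    _ = ⨆ n, M.law (s n) := hmono.measure_iUnion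
    _ ≤ c := iSup_le fun n => h _ (by
        have : 0 < 1 / ((n : ℝ) + 1) := by positivity
        linarith)

lemma exists_isLeast_PFA_le (hac : M.P₁ ≪ M.P₀) {β : ℝ} {b : WithBot ℝ}
    (hb : ∀ᶠ a : ℝ in atTop, M.ANO (M.twoThreshold a b) ≤ ENNReal.ofReal β) :
    ∀ᶠ α : ℝ in 𝓝[>] 0, ∃ a : ℝ,
      IsLeast {a' : ℝ | M.PFA (M.twoThreshold a' b) ≤ ENNReal.ofReal α} a ∧
      b < (a : WithBot ℝ) ∧ a ≤ Real.log ((1 - α) / α) ∧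
      M.twoThreshold a b ∈ M.Feasible α β := by
  -- The reference level is `b` itself, or `0` if `b = -∞`. Once `α` is below the positive PFA at
  -- this level, every admissible `a` lies above it: this gives both `b < a` and a lower bound for
  -- the infimum.
  have hpos := M.PFA_twoThreshold_pos hac (b.unbotD 0) b
  have hlim : Tendsto ENNReal.ofReal (𝓝[>] 0) (𝓝 0) := by
    have := (ENNReal.continuous_ofReal.tendsto 0).mono_left (nhdsWithin_le_nhds (s := Set.Ioi 0))
    rwa [ENNReal.ofReal_zero] at this
  filter_upwards [hlim.eventually (gt_mem_nhds hpos), self_mem_nhdsWithin,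
    nhdsWithin_le_nhds (gt_mem_nhds one_pos)] with α hα hα₀ hα₁
  have hα₀' : 0 < α := hα₀
  set S := {a' : ℝ | M.PFA (M.twoThreshold a' b) ≤ ENNReal.ofReal α} with hS
  have hlb : ∀ a' ∈ S, b.unbotD 0 < a' := by
    intro a' ha'
    by_contra hle
    have h₁ := M.PFA_twoThreshold_anti b (not_lt.mp hle)
    exact absurd (hα.trans_le (h₁.trans ha')) (lt_irrefl _)
  have hmem : Real.log ((1 - α) / α) ∈ S := by
    have hq : 0 < (1 - α) / α := div_pos (by linarith) hα₀'
    have h := M.PFA_twoThreshold_le hac (Real.log ((1 - α) / α)) b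
    have he : (1 + Real.exp (Real.log ((1 - α) / α)))⁻¹ = α := by
      rw [Real.exp_log hq]
      field_simp
      ring
    rwa [he] at h
  have hbdd : BddBelow S := ⟨b.unbotD 0, fun a' ha' => (hlb a' ha').le⟩
  have hInf : sInf S ∈ S := by
    refine M.PFA_twoThreshold_le_of_forall_gt fun a' ha' => ?_
    obtain ⟨c, hc, hca⟩ := exists_lt_of_csInf_lt ⟨_, hmem⟩ ha'
    exact (M.PFA_twoThreshold_anti b hca.le).trans hc
  refine ⟨sInf S, ⟨hInf, fun a' ha' => csInf_le hbdd ha'⟩, ?_, csInf_le hbdd hmem, hInf, ?_⟩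
  · have h := hlb _ hInf
    induction b using WithBot.recBotCoe with
    | bot => exact WithBot.bot_lt_coe _
    | coe b => exact WithBot.coe_lt_coe.mpr h
  · obtain ⟨a', ha', hle⟩ := (hb.and (eventually_ge_atTop (sInf S))).exists
    exact (M.ANO_twoThreshold_mono b hle).trans ha'

end ChangeModel
end QCD

/-! ### The lower bound for the delay of every policy. -/

namespace QCD
namespace ChangeModel

variable {𝒳 : Type*} [MeasurableSpace 𝒳] (M : ChangeModel 𝒳)

/-- The growth rate `D(f₁, f₀) + |log (1 - ρ)|` of the log posterior odds after the change. -/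
noncomputable def rate : ℝ := M.kl - Real.log (1 - M.ρ)

lemma log_one_sub_ρ_neg : Real.log (1 - M.ρ) < 0 :=
  Real.log_neg (by linarith [M.ρ_lt_one]) (by linarith [M.ρ_pos])

lemma rate_pos (hKL : InformationTheory.klDiv M.P₁ M.P₀ ≠ ∞) : 0 < M.rate := by
  have := M.kl_nonneg hKL
  have := M.log_one_sub_ρ_neg
  unfold rate; linarith

lemma map_eval_pathLaw {l i : ℕ} (hli : l ≤ i) :
    (M.pathLaw l).map (fun x => x i) = M.P₁ := by
  have h := Measure.infinitePi_map_eval (M.coordLaw l) i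
  have hc : M.coordLaw l i = M.P₁ := if_neg (by omega)
  rw [hc] at h
  exact h

/-- The weak law of large numbers for the log-likelihood ratio after the change. -/
lemma tendsto_pathLaw_log_L_sum (hKL : InformationTheory.klDiv M.P₁ M.P₀ ≠ ∞) (l : ℕ) {c : ℝ}
    (hc : M.kl < c) :
    Tendsto (fun N : ℕ => M.pathLaw l
      {x | c * N < ∑ i ∈ Finset.range N, Real.log (M.L (x (l + i)))}) atTop (𝓝 0) := by
  have hlog : Measurable fun y => Real.log (M.L y) := M.measurable_L.log
  have hmeas : ∀ i : ℕ, Measurable fun x : ℕ → 𝒳 => Real.log (M.L (x (l + i))) :=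
    fun i => hlog.comp (measurable_pi_apply _)
  have hmap : ∀ i : ℕ, (M.pathLaw l).map (fun x => Real.log (M.L (x (l + i))))
      = M.P₁.map fun y => Real.log (M.L y) := by
    intro i
    rw [← M.map_eval_pathLaw (Nat.le_add_right l i), Measure.map_map hlog (measurable_pi_apply _)]
    rfl
  have hind : ProbabilityTheory.iIndepFun (fun i (x : ℕ → 𝒳) => Real.log (M.L (x i)))
      (M.pathLaw l) :=
    ProbabilityTheory.iIndepFun_infinitePi (P := M.coordLaw l)
      (X := fun _ y => Real.log (M.L y)) fun _ => hlog
  have hint : Integrable (fun x : ℕ → 𝒳 => Real.log (M.L (x (l + 0)))) (M.pathLaw l) := by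
    have h := M.integrable_log_L hKL
    rw [← M.map_eval_pathLaw (Nat.le_add_right l 0)] at h
    exact h.comp_measurable (measurable_pi_apply _)
  have hmean : ∫ x, Real.log (M.L (x (l + 0))) ∂M.pathLaw l = M.kl := by
    rw [kl, ← M.map_eval_pathLaw (Nat.le_add_right l 0),
      integral_map (measurable_pi_apply _).aemeasurable hlog.aestronglyMeasurable]
  have hlln := ProbabilityTheory.strong_law_ae_real
    (fun i (x : ℕ → 𝒳) => Real.log (M.L (x (l + i)))) hint
    (fun i j hij => hind.indepFun (by omega : l + i ≠ l + j))
    (fun i => ⟨(hmeas i).aemeasurable, (hmeas 0).aemeasurable, by rw [hmap, hmap]⟩)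
  rw [hmean] at hlln
  have hms : ∀ N : ℕ, Measurable fun x : ℕ → 𝒳 =>
      (∑ i ∈ Finset.range N, Real.log (M.L (x (l + i)))) / N :=
    fun N => (Finset.measurable_fun_sum _ fun i _ => hmeas i).div_const _
  have htm := tendstoInMeasure_of_tendsto_ae (g := fun _ => M.kl)
    (fun N => (hms N).aestronglyMeasurable) hlln
  rw [tendstoInMeasure_iff_dist] at htm
  refine tendsto_of_tendsto_of_tendsto_of_le_of_le' tendsto_const_nhds
    (htm (c - M.kl) (by linarith)) (Eventually.of_forall fun _ => zero_le) ?_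
  filter_upwards [eventually_gt_atTop 0] with N hN
  refine measure_mono fun x hx => ?_
  have hN' : (0 : ℝ) < N := Nat.cast_pos.mpr hN
  have hx' : c < (∑ i ∈ Finset.range N, Real.log (M.L (x (l + i)))) / N :=
    (lt_div_iff₀ hN').mpr hx
  change c - M.kl ≤ dist _ _
  rw [Real.dist_eq]
  exact le_trans (by linarith) (le_abs_self _)

lemma prod_L_le_exp {l N : ℕ} {c : ℝ} {x : ℕ → 𝒳}
    (hx : ∑ i ∈ Finset.range N, Real.log (M.L (x (l + i))) ≤ c) :
    ∏ i ∈ Finset.range N, M.L (x (l + i)) ≤ Real.exp c := by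
  -- Since `Real.log 0 = 0`, the sum of logarithms says nothing about a vanishing factor; but then
  -- the product is zero.
  by_cases h : ∃ i ∈ Finset.range N, M.L (x (l + i)) = 0
  · obtain ⟨i, hi, h₀⟩ := h
    rw [Finset.prod_eq_zero hi h₀]
    exact (Real.exp_pos c).le
  · push Not at h
    rw [← Real.log_prod h] at hx
    have hpos : 0 < ∏ i ∈ Finset.range N, M.L (x (l + i)) :=
      Finset.prod_pos fun i hi => (M.L_nonneg _).lt_of_ne (h i hi).symm
    exact (Real.log_le_iff_le_exp hpos).mp hx

/-- Change of measure from `l` to `l + N`, truncated where the likelihood ratio exceeds `exp c`. All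
`N` observations enter the ratio, even those that `γ` skips. -/
lemma pathLaw_stopTime_lt_le (hac : M.P₁ ≪ M.P₀) (γ : Policy 𝒳) (l N : ℕ) (c : ℝ) :
    M.pathLaw l {x | γ.stopTime x < ((l + N : ℕ) : ℕ∞)}
      ≤ ENNReal.ofReal (Real.exp c) *
          M.pathLaw (l + N) {x | γ.stopTime x < ((l + N : ℕ) : ℕ∞)}
        + M.pathLaw l {x | c < ∑ i ∈ Finset.range N, Real.log (M.L (x (l + i)))} := by
  set E := {x : ℕ → 𝒳 | γ.stopTime x < ((l + N : ℕ) : ℕ∞)} with hE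
  set G := {x : ℕ → 𝒳 | c < ∑ i ∈ Finset.range N, Real.log (M.L (x (l + i)))} with hG
  have hmE : MeasurableSet E := γ.measurableSet_stopTime_lt _
  have hmG : MeasurableSet G := measurableSet_lt measurable_const
    (Finset.measurable_fun_sum _ fun i _ => M.measurable_L.log.comp (measurable_pi_apply _))
  have hsub : E ⊆ (E \ G) ∪ G := by rw [Set.sdiff_union_self]; exact Set.subset_union_left
  refine (measure_mono hsub).trans ((measure_union_le _ _).trans ?_)
  gcongr
  have hm := hmE.diff hmG
  rw [← lintegral_indicator_one hm, M.lintegral_pathLaw_add hac l N (measurable_one.indicator hm),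
    ← lintegral_indicator_one hmE, ← lintegral_const_mul' _ _ ENNReal.ofReal_ne_top]
  refine lintegral_mono fun x => ?_
  by_cases hx : x ∈ E \ G
  · rw [Set.indicator_of_mem hx, Set.indicator_of_mem hx.1]
    gcongr
    exact M.prod_L_le_exp (not_lt.mp hx.2)
  · rw [Set.indicator_of_notMem hx, mul_zero]
    exact zero_le

/-- For every `Γ > m`, stopping before `m` is a false alarm, and its probability is the same for all
these `Γ` because it depends only on observations before `m`. -/
lemma tail_mul_le_PFA (γ : Policy 𝒳) (m : ℕ) :
    ENNReal.ofReal (M.tail m) * M.pathLaw m {x | γ.stopTime x < (m : ℕ∞)} ≤ M.PFA γ := by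
  rw [M.PFA_eq, M.tsum_prior_eq_add m, ← tsum_ofReal_prior_shift, ← ENNReal.tsum_mul_right]
  refine le_add_left (ENNReal.tsum_le_tsum fun j => mul_le_mul_right ?_ _)
  rw [M.pathLaw_apply_eq (show m ≤ m + 1 + j by omega) (γ.measurableSet_stopTime_lt m)
    fun i hi x y => γ.stopTime_lt_update hi x y]
  exact measure_mono (γ.setOf_stopTime_lt_mono (by omega))

lemma pathLaw_stopTime_lt_le_of_PFA_le (hac : M.P₁ ≪ M.P₀) {γ : Policy 𝒳} {α : ℝ}
    (hγ : M.PFA γ ≤ ENNReal.ofReal α) (l N : ℕ) (c : ℝ) :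
    M.pathLaw l {x | γ.stopTime x < ((l + N : ℕ) : ℕ∞)}
      ≤ ENNReal.ofReal (α * Real.exp ((c - Real.log (1 - M.ρ)) * N) / M.tail l)
        + M.pathLaw l {x | c * N < ∑ i ∈ Finset.range N, Real.log (M.L (x (l + i)))} := by
  refine (M.pathLaw_stopTime_lt_le hac γ l N (c * N)).trans ?_
  gcongr
  have hs : 0 < 1 - M.ρ := by linarith [M.ρ_lt_one]
  have ht := M.tail_pos (l + N)
  have h := (M.tail_mul_le_PFA γ (l + N)).trans hγ
  have h' : M.pathLaw (l + N) {x | γ.stopTime x < ((l + N : ℕ) : ℕ∞)}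
      ≤ ENNReal.ofReal (α / M.tail (l + N)) := by
    rw [ENNReal.ofReal_div_of_pos ht, ENNReal.le_div_iff_mul_le
      (Or.inl (ENNReal.ofReal_pos.mpr ht).ne') (Or.inl ENNReal.ofReal_ne_top), mul_comm]
    exact h
  refine (mul_le_mul_right h' _).trans ?_
  rw [← ENNReal.ofReal_mul (Real.exp_pos _).le]
  refine ENNReal.ofReal_le_ofReal (le_of_eq ?_)
  -- The decay of the prior tail is where `|log (1 - ρ)|` enters the rate.
  have htail : M.tail (l + N) = M.tail l * Real.exp (Real.log (1 - M.ρ) * N) := by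
    rw [mul_comm (Real.log _), Real.exp_nat_mul, Real.exp_log hs, tail, tail, pow_add]
    ring
  rw [htail, sub_mul, Real.exp_sub]
  have := (M.tail_pos l).ne'
  field_simp

/-- With prior mass at least `1 - δ` on `Γ ≤ n`, each of the first `N` delay steps is survived with
probability at least `1 - δ`. -/
lemma ADD_ge_sum (γ : Policy 𝒳) (n N : ℕ) {δ : ℝ} (hδ : 0 ≤ δ) (hδ₁ : δ ≤ 1)
    (h : ∀ l ∈ Finset.range (n + 1),
      M.pathLaw l {x | γ.stopTime x < ((l + N : ℕ) : ℕ∞)} ≤ ENNReal.ofReal δ)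
    (hn : M.tail n ≤ δ) :
    ENNReal.ofReal ((1 - δ) * (N * (1 - δ))) ≤ M.ADD γ := by
  have hsum : ENNReal.ofReal (1 - δ) ≤ ∑ l ∈ Finset.range (n + 1), ENNReal.ofReal (M.prior l) := by
    have hs := M.tsum_prior_eq_add n fun _ => 1
    simp only [mul_one, tsum_ofReal_prior, tsum_ofReal_prior_shift] at hs
    rw [ENNReal.ofReal_sub _ hδ, ENNReal.ofReal_one, tsub_le_iff_right, hs]
    gcongr
  rw [M.ADD_eq, M.tsum_prior_eq_add n, ENNReal.ofReal_mul (by linarith)]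
  refine le_add_right ((mul_le_mul_left hsum _).trans ?_)
  rw [Finset.sum_mul]
  refine Finset.sum_le_sum fun l hl => ?_
  gcongr
  have hc : ∀ k ∈ Finset.range N, ENNReal.ofReal (1 - δ)
      ≤ M.pathLaw l {x | γ.stopTime x < ((l + k + 1 : ℕ) : ℕ∞)}ᶜ := by
    intro k hk
    rw [Finset.mem_range] at hk
    rw [prob_compl_eq_one_sub (γ.measurableSet_stopTime_lt _), ENNReal.ofReal_sub _ hδ,
      ENNReal.ofReal_one]
    exact tsub_le_tsub_left
      ((measure_mono (γ.setOf_stopTime_lt_mono (by omega))).trans (h l hl)) _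
  calc ENNReal.ofReal (N * (1 - δ))
      = ∑ k ∈ Finset.range N, ENNReal.ofReal (1 - δ) := by
        rw [Finset.sum_const, Finset.card_range, nsmul_eq_mul, ENNReal.ofReal_mul N.cast_nonneg,
          ENNReal.ofReal_natCast]
    _ ≤ ∑ k ∈ Finset.range N, M.pathLaw l {x | γ.stopTime x < ((l + k + 1 : ℕ) : ℕ∞)}ᶜ :=
        Finset.sum_le_sum hc
    _ ≤ _ := ENNReal.sum_le_tsum _

lemma tendsto_neg_log_nhdsGT_zero : Tendsto (fun α : ℝ => -Real.log α) (𝓝[>] 0) atTop :=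
  tendsto_neg_atBot_atTop.comp Real.tendsto_log_nhdsGT_zero

/-- Asymptotic lower bound for the delay of every policy with a given probability of false
alarm. -/
lemma eventually_le_ADD (hKL : InformationTheory.klDiv M.P₁ M.P₀ ≠ ∞) {c : ℝ}
    (hc : M.rate < c) :
    ∀ᶠ α : ℝ in 𝓝[>] 0, ∀ γ : Policy 𝒳, M.PFA γ ≤ ENNReal.ofReal α →
      ENNReal.ofReal (-Real.log α / c) ≤ M.ADD γ := by
  have hac := (InformationTheory.klDiv_ne_top_iff.mp hKL).1
  have hr := M.rate_pos hKL
  obtain ⟨c₂, h₂, hc₂⟩ := exists_between hc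
  obtain ⟨c₁, h₁, hc₁⟩ := exists_between h₂
  have hc0 : 0 < c := hr.trans hc
  have hc₂0 : 0 < c₂ := hr.trans h₂
  have hc₁0 : 0 < c₁ := hr.trans h₁
  -- Chosen so that `(1 - δ)² ≥ 1 - 2δ = (1 + c₂ / c) / 2`, halfway between `c₂ / c` and `1`; the
  -- remaining room absorbs the rounding of `N = ⌊-log α / c₂⌋`.
  set δ : ℝ := (1 - c₂ / c) / 4 with hδ
  have hq : c₂ / c < 1 := (div_lt_one hc0).mpr hc₂
  have hq0 : 0 < c₂ / c := div_pos hc₂0 hc0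
  have hδ0 : 0 < δ := by linarith
  have hδ1 : δ < 1 := by linarith
  have hlog := tendsto_neg_log_nhdsGT_zero
  have hN : Tendsto (fun α : ℝ => ⌊-Real.log α / c₂⌋₊) (𝓝[>] 0) atTop :=
    tendsto_nat_floor_atTop.comp (hlog.atTop_div_const hc₂0)
  obtain ⟨n, hn⟩ := (M.tendsto_tail.eventually (gt_mem_nhds hδ0)).exists
  -- The gap `c₁ < c₂` bounds the first term by a multiple of `α ^ (1 - c₁ / c₂)`; the gap `rate <
  -- c₁` makes the law of large numbers apply to the second. Neither involves the policy, hence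
  -- uniformity over all `γ`.
  have hterm : ∀ l ∈ Finset.range (n + 1), ∀ᶠ α : ℝ in 𝓝[>] 0,
      ENNReal.ofReal (α * Real.exp (c₁ * ⌊-Real.log α / c₂⌋₊) / M.tail l)
        + M.pathLaw l {x | (c₁ + Real.log (1 - M.ρ)) * ⌊-Real.log α / c₂⌋₊
            < ∑ i ∈ Finset.range ⌊-Real.log α / c₂⌋₊, Real.log (M.L (x (l + i)))}
        ≤ ENNReal.ofReal δ := by
    intro l _
    have hA : Tendsto (fun α : ℝ => α * Real.exp (c₁ * ⌊-Real.log α / c₂⌋₊) / M.tail l)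
        (𝓝[>] 0) (𝓝 0) := by
      have hexp : Tendsto (fun α : ℝ => Real.exp (-((1 - c₁ / c₂) * -Real.log α)) / M.tail l)
          (𝓝[>] 0) (𝓝 0) := by
        have hpos : 0 < 1 - c₁ / c₂ := by
          rw [sub_pos]; exact (div_lt_one hc₂0).mpr hc₁
        have := (Real.tendsto_exp_neg_atTop_nhds_zero.comp
          (hlog.const_mul_atTop hpos)).div_const (M.tail l)
        rwa [zero_div] at this
      refine tendsto_of_tendsto_of_tendsto_of_le_of_le' tendsto_const_nhds hexp ?_ ?_
      · filter_upwards [self_mem_nhdsWithin] with α hα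
        have hα' : (0 : ℝ) < α := hα
        have := M.tail_pos l
        positivity
      · filter_upwards [self_mem_nhdsWithin, hlog.eventually_ge_atTop 0] with α hα hα₁
        have hα' : (0 : ℝ) < α := hα
        have hfl : (⌊-Real.log α / c₂⌋₊ : ℝ) ≤ -Real.log α / c₂ :=
          Nat.floor_le (div_nonneg hα₁ hc₂0.le)
        have := M.tail_pos l
        gcongr
        calc α * Real.exp (c₁ * ⌊-Real.log α / c₂⌋₊)
            ≤ Real.exp (Real.log α) * Real.exp (c₁ * (-Real.log α / c₂)) := by
              rw [Real.exp_log hα']; gcongr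
          _ = Real.exp (-((1 - c₁ / c₂) * -Real.log α)) := by
              rw [← Real.exp_add]; congr 1; ring
    have hA' : Tendsto (fun α : ℝ => ENNReal.ofReal
        (α * Real.exp (c₁ * ⌊-Real.log α / c₂⌋₊) / M.tail l)) (𝓝[>] 0) (𝓝 0) := by
      have := (ENNReal.continuous_ofReal.tendsto 0).comp hA
      rwa [ENNReal.ofReal_zero] at this
    have hB := (M.tendsto_pathLaw_log_L_sum hKL l (c := c₁ + Real.log (1 - M.ρ))
      (by unfold rate at h₁; linarith)).comp hN
    have hAB := hA'.add hB
    rw [add_zero] at hAB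
    exact (hAB.eventually (gt_mem_nhds (ENNReal.ofReal_pos.mpr hδ0))).mono fun _ h => h.le
  have hbig : ∀ᶠ α : ℝ in 𝓝[>] 0, 1 ≤ (1 / 4) * (1 / c₂ - 1 / c) * -Real.log α := by
    have hpos : 0 < (1 / 4) * (1 / c₂ - 1 / c) :=
      mul_pos (by norm_num) (sub_pos.mpr (one_div_lt_one_div_of_lt hc₂0 hc₂))
    exact (hlog.const_mul_atTop hpos).eventually_ge_atTop 1
  filter_upwards [(Finset.eventually_all _).mpr hterm, self_mem_nhdsWithin,
    hlog.eventually_ge_atTop 0, hbig] with α hα hα0 hα₁ hα₂ γ hγ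
  refine le_trans (ENNReal.ofReal_le_ofReal ?_)
    (M.ADD_ge_sum γ n ⌊-Real.log α / c₂⌋₊ hδ0.le hδ1.le (fun l hl => ?_) hn.le)
  · have hfl : -Real.log α / c₂ - 1 ≤ ⌊-Real.log α / c₂⌋₊ := (Nat.sub_one_lt_floor _).le
    set ℓ := -Real.log α with hℓ
    have hsq : (1 + c₂ / c) / 2 ≤ (1 - δ) * (1 - δ) := by nlinarith
    have hx : ℓ / c₂ * (1 - c₂ / c) = (1 / c₂ - 1 / c) * ℓ := by field_simp
    have hy : ℓ / c = ℓ / c₂ * (c₂ / c) := by field_simp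
    have hz : 0 ≤ ℓ / c₂ - 1 := by
      have h4 : (1 / 4) * (1 / c₂ - 1 / c) * ℓ ≤ ℓ / c₂ := by
        have : 0 ≤ ℓ / c₂ := div_nonneg hα₁ hc₂0.le
        nlinarith
      linarith
    calc ℓ / c ≤ (ℓ / c₂ - 1) * ((1 + c₂ / c) / 2) := by
          rw [hy]; nlinarith
      _ ≤ ⌊ℓ / c₂⌋₊ * ((1 - δ) * (1 - δ)) := by gcongr
      _ = _ := by ring
  · have h := M.pathLaw_stopTime_lt_le_of_PFA_le hac hγ l ⌊-Real.log α / c₂⌋₊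
      (c₁ + Real.log (1 - M.ρ))
    rw [add_sub_cancel_right] at h
    exact h.trans (hα l hl)

end ChangeModel
end QCD

/-! ### The upper bound for the two-threshold delay, by a Lyapunov function. -/

namespace QCD
namespace ChangeModel

variable {𝒳 : Type*} [MeasurableSpace 𝒳] (M : ChangeModel 𝒳)

/-- The bound does not depend on `η`, so it serves as dominating function when `η → 0`. -/
lemma abs_log_add_div_le {η s t : ℝ} (hη : 0 < η) (hη₁ : η ≤ 1) (hs : 0 < s) (ht : 0 < t) :
    |Real.log (η + s / t)| ≤ |Real.log s| + |Real.log t| + s * t⁻¹ := by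
  have hst : 0 < s / t := div_pos hs ht
  have h₁ : Real.log (s / t) ≤ Real.log (η + s / t) := Real.log_le_log hst (by linarith)
  have h₂ : Real.log (η + s / t) ≤ s / t := by
    have := Real.log_le_sub_one_of_pos (show 0 < η + s / t by linarith)
    linarith
  rw [Real.log_div hs.ne' ht.ne'] at h₁
  rw [div_eq_mul_inv] at h₁ h₂ ⊢
  have h₃ := neg_abs_le (Real.log s)
  have h₄ := le_abs_self (Real.log t)
  have h₅ := abs_nonneg (Real.log s)
  have h₆ := abs_nonneg (Real.log t)
  have h₇ : 0 < s * t⁻¹ := by positivity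
  rw [abs_le]
  constructor <;> linarith

lemma integrable_log_add_div (hKL : InformationTheory.klDiv M.P₁ M.P₀ ≠ ∞) {η : ℝ}
    (hη : 0 < η) (hη₁ : η ≤ 1) :
    Integrable (fun x => Real.log (η + (1 - M.ρ) / M.L x)) M.P₁ := by
  have hac := (InformationTheory.klDiv_ne_top_iff.mp hKL).1
  have hs : 0 < 1 - M.ρ := by linarith [M.ρ_lt_one]
  refine Integrable.mono' (((integrable_const |Real.log (1 - M.ρ)|).add
    (M.integrable_log_L hKL).abs).add ((M.integrable_inv_L hac).const_mul (1 - M.ρ)))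
    ((measurable_const.div M.measurable_L).const_add η).log.aestronglyMeasurable ?_
  filter_upwards [M.L_pos_ae hac] with x hx
  exact abs_log_add_div_le hη hη₁ hs hx

/-- At `η = 0` the integral is `-rate`; dominated convergence along `η = 1 / (n + 1)` leaves it
below `-c` for some positive `η`. -/
lemma exists_integral_log_le (hKL : InformationTheory.klDiv M.P₁ M.P₀ ≠ ∞) {c : ℝ}
    (hc : c < M.rate) :
    ∃ η : ℝ, 0 < η ∧ η ≤ 1 ∧ ∫ x, Real.log (η + (1 - M.ρ) / M.L x) ∂M.P₁ ≤ -c := by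
  have hac := (InformationTheory.klDiv_ne_top_iff.mp hKL).1
  have hs : 0 < 1 - M.ρ := by linarith [M.ρ_lt_one]
  have hη : ∀ n : ℕ, 0 < 1 / ((n : ℝ) + 1) ∧ 1 / ((n : ℝ) + 1) ≤ 1 := fun n =>
    ⟨by positivity, by
      rw [div_le_one (by positivity)]
      linarith [n.cast_nonneg (α := ℝ)]⟩
  have hlim : Tendsto (fun n : ℕ => ∫ x, Real.log (1 / ((n : ℝ) + 1) + (1 - M.ρ) / M.L x) ∂M.P₁)
      atTop (𝓝 (∫ x, (Real.log (1 - M.ρ) - Real.log (M.L x)) ∂M.P₁)) := by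
    refine tendsto_integral_of_dominated_convergence
      (fun x => |Real.log (1 - M.ρ)| + |Real.log (M.L x)| + (1 - M.ρ) * (M.L x)⁻¹)
      (fun n => ((measurable_const.div M.measurable_L).const_add _).log.aestronglyMeasurable)
      (((integrable_const _).add (M.integrable_log_L hKL).abs).add
        ((M.integrable_inv_L hac).const_mul _)) (fun n => ?_) ?_
    · filter_upwards [M.L_pos_ae hac] with x hx
      exact abs_log_add_div_le (hη n).1 (hη n).2 hs hx
    · filter_upwards [M.L_pos_ae hac] with x hx
      rw [← Real.log_div hs.ne' hx.ne']
      have h := (tendsto_one_div_add_atTop_nhds_zero_nat (𝕜 := ℝ)).add_const ((1 - M.ρ) / M.L x)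
      rw [zero_add] at h
      exact h.log (div_pos hs hx).ne'
  have hval : ∫ x, (Real.log (1 - M.ρ) - Real.log (M.L x)) ∂M.P₁ = -M.rate := by
    rw [integral_sub (integrable_const _) (M.integrable_log_L hKL)]
    simp [rate, kl]
  rw [hval] at hlim
  obtain ⟨n, hn⟩ := (hlim.eventually (gt_mem_nhds (neg_lt_neg hc))).exists
  exact ⟨_, (hη n).1, (hη n).2, hn.le⟩

/-- The Lyapunov function for the delay, in terms of the prior odds `q` of the next period. -/
noncomputable def lyap (C K q : ℝ) : ℝ := Real.log (1 + C / q) + K / q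

lemma lyap_nonneg {C K q : ℝ} (hC : 0 ≤ C) (hK : 0 ≤ K) (hq : 0 < q) : 0 ≤ lyap C K q :=
  add_nonneg (Real.log_nonneg (le_add_of_nonneg_right (by positivity))) (by positivity)

lemma lyap_anti {C K q q' : ℝ} (hC : 0 ≤ C) (hK : 0 ≤ K) (hq : 0 < q) (h : q ≤ q') :
    lyap C K q' ≤ lyap C K q := by
  have hq' : 0 < q' := hq.trans_le h
  unfold lyap
  gcongr

lemma measurable_lyap (C K : ℝ) : Measurable (lyap C K) :=
  ((measurable_const.div measurable_id).const_add 1).log.add (measurable_const.div measurable_id)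

/-- A skipped step multiplies `q` by at least `1 / (1 - ρ)`, so `K / q` alone drops by `K ρ / q ≥ K
ρ / qb ≥ c`; the logarithm does not increase. -/
lemma lyap_skip_add_le {C K q qb c : ℝ} (hC : 0 ≤ C) (hK : 0 ≤ K) (hq : 0 < q) (hqb : q ≤ qb)
    (hc : c * qb ≤ K * M.ρ) (hc₀ : 0 ≤ c) :
    lyap C K ((q + M.ρ) / (1 - M.ρ)) + c ≤ lyap C K q := by
  have hρ := M.ρ_pos
  have hs : 0 < 1 - M.ρ := by linarith [M.ρ_lt_one]
  have hle : q ≤ (q + M.ρ) / (1 - M.ρ) := by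
    rw [le_div_iff₀ hs]; nlinarith
  have hlog : Real.log (1 + C / ((q + M.ρ) / (1 - M.ρ))) ≤ Real.log (1 + C / q) := by
    have : 0 < (q + M.ρ) / (1 - M.ρ) := hq.trans_le hle
    gcongr
  have hK' : K / ((q + M.ρ) / (1 - M.ρ)) + c ≤ K / q := by
    have h₁ : K / ((q + M.ρ) / (1 - M.ρ)) ≤ K * (1 - M.ρ) / q := by
      rw [div_div_eq_mul_div]
      gcongr
      linarith
    have h₂ : c ≤ K * M.ρ / q := by
      rw [le_div_iff₀ hq]
      exact (mul_le_mul_of_nonneg_left hqb hc₀).trans hc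
    have h₃ : K * (1 - M.ρ) / q + K * M.ρ / q = K / q := by
      rw [← add_div]; congr 1; ring
    linarith
  unfold lyap
  linarith

/-- The drift of a sampled step. As `q ≤ η C`, the summand `1` inside the new logarithm is at most
`η C / q`, so `C / q` factors out and leaves `log (η + (1 - ρ) / L)`, of mean at most `-c`. The `K /
q` part does not grow, since `1 / L` has mean at most one. -/
lemma lintegral_lyap_add_le (hKL : InformationTheory.klDiv M.P₁ M.P₀ ≠ ∞) {C K q c η : ℝ}
    (hη : 0 < η) (hη₁ : η ≤ 1) (hC : 0 < C) (hK : 0 ≤ K) (hq : 0 < q) (hqC : q ≤ η * C)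
    (hc₀ : 0 ≤ c) (hc : ∫ x, Real.log (η + (1 - M.ρ) / M.L x) ∂M.P₁ ≤ -c) :
    ∫⁻ x, ENNReal.ofReal (lyap C K ((q * M.L x + M.ρ) / (1 - M.ρ))) ∂M.P₁ + ENNReal.ofReal c
      ≤ ENNReal.ofReal (lyap C K q) := by
  have hac := (InformationTheory.klDiv_ne_top_iff.mp hKL).1
  have hρ := M.ρ_pos
  have hs : 0 < 1 - M.ρ := by linarith [M.ρ_lt_one]
  set g : 𝒳 → ℝ := fun x =>
    Real.log (C / q) + Real.log (η + (1 - M.ρ) / M.L x) + K / q * (1 - M.ρ) * (M.L x)⁻¹ with hg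
  have hle : ∀ᵐ x ∂M.P₁, lyap C K ((q * M.L x + M.ρ) / (1 - M.ρ)) ≤ g x := by
    filter_upwards [M.L_pos_ae hac] with x hx
    have hqL : 0 < q * M.L x := mul_pos hq hx
    have h₁ := lyap_anti (C := C) (K := K) hC.le hK (div_pos hqL hs)
      (show q * M.L x / (1 - M.ρ) ≤ (q * M.L x + M.ρ) / (1 - M.ρ) by gcongr; linarith)
    refine h₁.trans ?_
    have h₂ : 1 + C / (q * M.L x / (1 - M.ρ)) ≤ C / q * (η + (1 - M.ρ) / M.L x) := by
      have : 1 ≤ C / q * η := by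
        rw [div_mul_eq_mul_div, le_div_iff₀ hq]; linarith
      have h₃ : C / (q * M.L x / (1 - M.ρ)) = C / q * ((1 - M.ρ) / M.L x) := by field_simp
      rw [h₃, mul_add]
      linarith
    have hpos : 0 < 1 + C / (q * M.L x / (1 - M.ρ)) := by positivity
    have h₄ := Real.log_le_log hpos h₂
    rw [Real.log_mul (by positivity) (by positivity)] at h₄
    have h₅ : K / (q * M.L x / (1 - M.ρ)) = K / q * (1 - M.ρ) * (M.L x)⁻¹ := by field_simp
    rw [lyap, h₅, hg]
    linarith
  have hlyap : ∀ x, 0 ≤ lyap C K ((q * M.L x + M.ρ) / (1 - M.ρ)) := fun x =>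
    lyap_nonneg hC.le hK (div_pos (add_pos_of_nonneg_of_pos
      (mul_nonneg hq.le (M.L_nonneg x)) hρ) hs)
  have hg0 : 0 ≤ᵐ[M.P₁] g := hle.mono fun x hx => (hlyap x).trans hx
  have hint₁ := (integrable_const (Real.log (C / q))).add (M.integrable_log_add_div hKL hη hη₁)
  have hint₂ := (M.integrable_inv_L hac).const_mul (K / q * (1 - M.ρ))
  have hgint : Integrable g M.P₁ := hint₁.add hint₂
  have hgval : ∫ x, g x ∂M.P₁ + c ≤ lyap C K q := by
    have h₁ : ∫ x, g x ∂M.P₁ = Real.log (C / q)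
        + ∫ x, Real.log (η + (1 - M.ρ) / M.L x) ∂M.P₁
        + K / q * (1 - M.ρ) * ∫ x, (M.L x)⁻¹ ∂M.P₁ := by
      refine (integral_add hint₁ hint₂).trans ?_
      rw [integral_const_mul]
      congr 1
      refine (integral_add (integrable_const _) (M.integrable_log_add_div hKL hη hη₁)).trans ?_
      simp
    have h₂ : K / q * (1 - M.ρ) * ∫ x, (M.L x)⁻¹ ∂M.P₁ ≤ K / q := by
      have hKq : 0 ≤ K / q := by positivity
      calc K / q * (1 - M.ρ) * ∫ x, (M.L x)⁻¹ ∂M.P₁ ≤ K / q * (1 - M.ρ) * 1 := by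
            gcongr
            exact M.integral_inv_L_le hac
        _ ≤ K / q := by nlinarith
    have h₃ : Real.log (C / q) ≤ Real.log (1 + C / q) :=
      Real.log_le_log (by positivity) (by linarith)
    rw [h₁, lyap]
    linarith
  calc _ ≤ ∫⁻ x, ENNReal.ofReal (g x) ∂M.P₁ + ENNReal.ofReal c := by
        exact add_le_add
          (lintegral_mono_ae (hle.mono fun x hx => ENNReal.ofReal_le_ofReal hx)) le_rfl
    _ = ENNReal.ofReal (∫ x, g x ∂M.P₁ + c) := by
        rw [← ofReal_integral_eq_lintegral_ofReal hgint hg0,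
          ENNReal.ofReal_add (integral_nonneg_of_ae hg0) hc₀]
    _ ≤ _ := ENNReal.ofReal_le_ofReal hgval

/-- The odds of `Γ ≤ k + 1` given the information at time `k`. -/
noncomputable def nextOdds (γ : Policy 𝒳) (k : ℕ) (x : ℕ → 𝒳) : ℝ :=
  (M.odds γ k x + M.ρ) / (1 - M.ρ)

lemma nextOdds_ge (γ : Policy 𝒳) (k : ℕ) (x : ℕ → 𝒳) :
    M.ρ / (1 - M.ρ) ≤ M.nextOdds γ k x := by
  have hs : 0 < 1 - M.ρ := by linarith [M.ρ_lt_one]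
  have := M.odds_nonneg γ k x
  unfold nextOdds
  gcongr
  linarith

lemma nextOdds_pos (γ : Policy 𝒳) (k : ℕ) (x : ℕ → 𝒳) : 0 < M.nextOdds γ k x :=
  (div_pos M.ρ_pos (by linarith [M.ρ_lt_one])).trans_le (M.nextOdds_ge γ k x)

lemma measurable_nextOdds (γ : Policy 𝒳) (k : ℕ) : Measurable (M.nextOdds γ k) :=
  ((M.measurable_odds γ k).add_const _).div_const _

lemma nextOdds_succ_update (γ : Policy 𝒳) (k : ℕ) (x : ℕ → 𝒳) (y : 𝒳) :
    M.nextOdds γ (k + 1) (Function.update x (k + 1) y)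
      = (M.nextOdds γ k x * (if γ.take k (γ.info x k) = true then M.L y else 1) + M.ρ)
        / (1 - M.ρ) := by
  rw [nextOdds, M.odds_succ, M.odds_update γ (Nat.lt_succ_self k),
    γ.info_update (Nat.lt_succ_self k), Function.update_self]
  rfl

/-- One step of the drift inequality for the Lyapunov function along the two-threshold policy. -/
lemma lintegral_lyap_nextOdds_add_le (hKL : InformationTheory.klDiv M.P₁ M.P₀ ≠ ∞)
    {C K c η a a' bmax : ℝ} {b : WithBot ℝ}
    (hη : 0 < η) (hη₁ : η ≤ 1) (hK : 0 ≤ K) (hc₀ : 0 ≤ c)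
    (hc : ∫ x, Real.log (η + (1 - M.ρ) / M.L x) ∂M.P₁ ≤ -c)
    (hC : η * C = (Real.exp a' + M.ρ) / (1 - M.ρ))
    (hKc : c * ((Real.exp bmax + M.ρ) / (1 - M.ρ)) ≤ K * M.ρ)
    (haa' : a ≤ a') (ha' : M.π₀ / (1 - M.π₀) ≤ Real.exp a') (hb : b ≤ (bmax : WithBot ℝ))
    {l k : ℕ} (hlk : l ≤ k) :
    (∫⁻ x in {x | (M.twoThreshold a b).stopTime x < ((k + 2 : ℕ) : ℕ∞)}ᶜ,
        ENNReal.ofReal (lyap C K (M.nextOdds (M.twoThreshold a b) (k + 1) x)) ∂M.pathLaw l)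
      + ENNReal.ofReal c *
        M.pathLaw l {x | (M.twoThreshold a b).stopTime x < ((k + 1 : ℕ) : ℕ∞)}ᶜ
      ≤ ∫⁻ x in {x | (M.twoThreshold a b).stopTime x < ((k + 1 : ℕ) : ℕ∞)}ᶜ,
        ENNReal.ofReal (lyap C K (M.nextOdds (M.twoThreshold a b) k x)) ∂M.pathLaw l := by
  have hρ := M.ρ_pos
  have hs : 0 < 1 - M.ρ := by linarith [M.ρ_lt_one]
  set γ := M.twoThreshold a b with hγ
  have hC0 : 0 < C := by
    have : 0 < η * C := by rw [hC]; positivity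
    exact pos_of_mul_pos_right this hη.le
  set A := {x : ℕ → 𝒳 | γ.stopTime x < ((k + 1 : ℕ) : ℕ∞)}ᶜ with hA
  have hmA : MeasurableSet A := (γ.measurableSet_stopTime_lt (k + 1)).compl
  have hsub : {x : ℕ → 𝒳 | γ.stopTime x < ((k + 2 : ℕ) : ℕ∞)}ᶜ ⊆ A :=
    Set.compl_subset_compl.mpr (γ.setOf_stopTime_lt_mono (Nat.le_succ _))
  -- Survival past time `k` is decided before observation `k + 1`, which can thus be integrated out
  -- on `A`, under `P₁` because `l ≤ k`.
  have hupd : ∀ x y, Function.update x (k + 1) y ∈ A ↔ x ∈ A :=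
    fun x y => (γ.stopTime_lt_update le_rfl x y).not
  have hF : Measurable fun x : ℕ → 𝒳 => ENNReal.ofReal (lyap C K (M.nextOdds γ (k + 1) x)) :=
    ((measurable_lyap C K).comp (M.measurable_nextOdds γ (k + 1))).ennreal_ofReal
  have hcoord : M.coordLaw l (k + 1) = M.P₁ := if_neg (by omega)
  have hbound : ∀ x ∈ A, M.nextOdds γ k x ≤ η * C := by
    intro x hx
    have hodds : M.odds γ k x ≤ Real.exp a' := by
      -- The policy cannot stop at time `0`, so there the bound on the odds has to come from the
      -- assumption on `π₀`.
      rcases Nat.eq_zero_or_pos k with rfl | hk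
      · exact ha'
      · by_contra hlt
        refine hx ((M.twoThreshold_stopTime_lt_iff a b x (k + 1)).mpr
          ⟨k, Nat.lt_succ_self k, hk, ?_⟩)
        exact (Real.exp_le_exp.mpr haa').trans_lt (not_le.mp hlt)
    rw [hC, nextOdds]
    gcongr
  have hstep : ∀ x ∈ A,
      ∫⁻ y, ENNReal.ofReal (lyap C K (M.nextOdds γ (k + 1) (Function.update x (k + 1) y))) ∂M.P₁
        + ENNReal.ofReal c ≤ ENNReal.ofReal (lyap C K (M.nextOdds γ k x)) := by
    intro x hx
    have hq := M.nextOdds_pos γ k x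
    simp only [M.nextOdds_succ_update]
    by_cases ht : γ.take k (γ.info x k) = true
    · simp only [ht, if_true]
      exact M.lintegral_lyap_add_le hKL hη hη₁ hC0 hK hq (hbound x hx) hc₀ hc
    · simp only [if_neg ht, mul_one, lintegral_const, measure_univ]
      have hodds : M.odds γ k x ≤ Real.exp bmax := by
        rw [hγ, M.twoThreshold_take, not_le] at ht
        have hlt := ht.trans_le (ofLogit_le_sigmoid hb)
        by_contra hgt
        exact absurd ((sigmoid_lt_iff_lt_odds (M.belief_mem _ _).2 bmax).mpr (not_le.mp hgt))
          hlt.not_gt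
      have hqb : M.nextOdds γ k x ≤ (Real.exp bmax + M.ρ) / (1 - M.ρ) := by
        unfold nextOdds; gcongr
      have hnn : 0 ≤ lyap C K ((M.nextOdds γ k x + M.ρ) / (1 - M.ρ)) :=
        lyap_nonneg hC0.le hK (by positivity)
      rw [← ENNReal.ofReal_add hnn hc₀]
      exact ENNReal.ofReal_le_ofReal (M.lyap_skip_add_le hC0.le hK hq hqb hKc hc₀)
  calc _ ≤ ∫⁻ x in A, ENNReal.ofReal (lyap C K (M.nextOdds γ (k + 1) x)) ∂M.pathLaw l
        + ENNReal.ofReal c * M.pathLaw l A := by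
        gcongr
    _ = ∫⁻ x in A, (∫⁻ y, ENNReal.ofReal
          (lyap C K (M.nextOdds γ (k + 1) (Function.update x (k + 1) y))) ∂M.P₁
        + ENNReal.ofReal c) ∂M.pathLaw l := by
        rw [lintegral_add_right _ measurable_const, setLIntegral_const]
        congr 1
        rw [← lintegral_indicator hmA, ← lintegral_indicator hmA,
          M.lintegral_pathLaw_update l (k + 1) (hF.indicator hmA), hcoord]
        refine lintegral_congr fun x => ?_
        by_cases hx : x ∈ A
        · rw [Set.indicator_of_mem hx]
          exact lintegral_congr fun y => Set.indicator_of_mem ((hupd x y).mpr hx) _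
        · rw [Set.indicator_of_notMem hx, ← lintegral_zero]
          exact lintegral_congr fun y => Set.indicator_of_notMem ((hupd x y).not.mpr hx) _
    _ ≤ _ := setLIntegral_mono' hmA hstep

/-- Upper bound for the delay of the two-threshold policy, uniform in the lower threshold. -/
lemma exists_ADD_twoThreshold_le (hKL : InformationTheory.klDiv M.P₁ M.P₀ ≠ ∞) {c : ℝ}
    (hc₀ : 0 < c) (hc : c < M.rate) (bmax : ℝ) :
    ∃ C₀ a₀ : ℝ, ∀ a' ≥ a₀, ∀ a ≤ a', ∀ b : WithBot ℝ, b ≤ (bmax : WithBot ℝ) →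
      M.ADD (M.twoThreshold a b) ≤ ENNReal.ofReal ((a' + C₀) / c) := by
  have hρ := M.ρ_pos
  have hs : 0 < 1 - M.ρ := by linarith [M.ρ_lt_one]
  obtain ⟨η, hη, hη₁, hηc⟩ := M.exists_integral_log_le hKL hc
  -- The smallest `K` that pays `c` for a skipped step at odds up to `exp bmax`; it depends on
  -- `bmax` but not on the thresholds.
  set K : ℝ := c * ((Real.exp bmax + M.ρ) / (1 - M.ρ)) / M.ρ with hK
  have hK0 : 0 ≤ K := by positivity
  have hKc : c * ((Real.exp bmax + M.ρ) / (1 - M.ρ)) ≤ K * M.ρ := by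
    rw [hK, div_mul_cancel₀ _ hρ.ne']
  refine ⟨Real.log (1 + (1 + M.ρ) / (M.ρ * η)) + K / (M.ρ / (1 - M.ρ)),
    max 0 (Real.log (1 + M.π₀ / (1 - M.π₀))), fun a' ha' a haa' b hb => ?_⟩
  have ha'0 : 0 ≤ a' := (le_max_left _ _).trans ha'
  have hπ : M.π₀ / (1 - M.π₀) ≤ Real.exp a' := by
    have h₀ : 0 ≤ M.π₀ / (1 - M.π₀) :=
      div_nonneg M.π₀_nonneg (by linarith [M.π₀_lt_one])
    have h := (Real.log_le_iff_le_exp (by linarith)).mp ((le_max_right _ _).trans ha')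
    linarith
  -- Makes `η C` the largest next-step odds before stopping. `C` is of order `exp a'`, so `log (1 +
  -- C / q)` starts at `a'` plus a bounded amount, whatever the odds at the change.
  set C : ℝ := (Real.exp a' + M.ρ) / (1 - M.ρ) / η with hCdef
  have hC : η * C = (Real.exp a' + M.ρ) / (1 - M.ρ) := mul_div_cancel₀ _ hη.ne'
  have hC0 : 0 ≤ C := by positivity
  set γ := M.twoThreshold a b with hγ
  have hq₀ : 0 < M.ρ / (1 - M.ρ) := div_pos hρ hs
  have hlyap : lyap C K (M.ρ / (1 - M.ρ))
      ≤ a' + (Real.log (1 + (1 + M.ρ) / (M.ρ * η)) + K / (M.ρ / (1 - M.ρ))) := by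
    have h₁ : 1 + C / (M.ρ / (1 - M.ρ)) ≤ Real.exp a' * (1 + (1 + M.ρ) / (M.ρ * η)) := by
      have he : 1 ≤ Real.exp a' := Real.one_le_exp ha'0
      have hCq : C / (M.ρ / (1 - M.ρ)) = (Real.exp a' + M.ρ) / (M.ρ * η) := by
        rw [hCdef]; field_simp
      have h₂ : (Real.exp a' + M.ρ) / (M.ρ * η) ≤ Real.exp a' * ((1 + M.ρ) / (M.ρ * η)) := by
        rw [← mul_div_assoc]
        gcongr
        nlinarith
      rw [hCq, mul_add, mul_one]
      linarith
    have h₂ := Real.log_le_log (by positivity) h₁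
    rw [Real.log_mul (Real.exp_pos _).ne' (by positivity), Real.log_exp] at h₂
    unfold lyap
    linarith
  have hdelay : ∀ l : ℕ, ∑' k : ℕ, M.pathLaw l {x | γ.stopTime x < ((l + k + 1 : ℕ) : ℕ∞)}ᶜ
      ≤ ENNReal.ofReal (lyap C K (M.ρ / (1 - M.ρ)) / c) := by
    intro l
    -- The drift inequality telescoped from the change point on. As `lyap` is nonnegative, its
    -- remaining value can be dropped, and the overshoot at stopping needs no estimate.
    have hsum : ∀ n : ℕ,
        (∫⁻ x in {x | γ.stopTime x < ((l + n + 1 : ℕ) : ℕ∞)}ᶜ,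
          ENNReal.ofReal (lyap C K (M.nextOdds γ (l + n) x)) ∂M.pathLaw l)
        + ENNReal.ofReal c * ∑ k ∈ Finset.range n,
          M.pathLaw l {x | γ.stopTime x < ((l + k + 1 : ℕ) : ℕ∞)}ᶜ
        ≤ ENNReal.ofReal (lyap C K (M.ρ / (1 - M.ρ))) := by
      intro n
      induction n with
      | zero =>
        rw [Finset.range_zero, Finset.sum_empty, mul_zero, add_zero]
        calc _ ≤ ∫⁻ x, ENNReal.ofReal (lyap C K (M.nextOdds γ (l + 0) x)) ∂M.pathLaw l :=
              setLIntegral_le_lintegral _ _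
          _ ≤ ∫⁻ _, ENNReal.ofReal (lyap C K (M.ρ / (1 - M.ρ))) ∂M.pathLaw l :=
              lintegral_mono fun x => ENNReal.ofReal_le_ofReal
                (lyap_anti hC0 hK0 hq₀ (M.nextOdds_ge γ _ x))
          _ = _ := by simp
      | succ n ih =>
        refine le_trans ?_ ih
        rw [Finset.sum_range_succ, mul_add, add_comm (ENNReal.ofReal c * ∑ k ∈ _, _),
          ← add_assoc]
        gcongr
        exact M.lintegral_lyap_nextOdds_add_le hKL hη hη₁ hK0 hc₀.le hηc hC hKc haa' hπ hb
          (Nat.le_add_right l n)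
    rw [ENNReal.ofReal_div_of_pos hc₀, ENNReal.le_div_iff_mul_le
      (Or.inl (ENNReal.ofReal_pos.mpr hc₀).ne') (Or.inl ENNReal.ofReal_ne_top), mul_comm,
      ENNReal.tsum_eq_iSup_nat, ENNReal.mul_iSup]
    exact iSup_le fun n => le_trans le_add_self (hsum n)
  rw [M.ADD_eq]
  calc _ ≤ ∑' l, ENNReal.ofReal (M.prior l) *
        ENNReal.ofReal (lyap C K (M.ρ / (1 - M.ρ)) / c) :=
        ENNReal.tsum_le_tsum fun l => by gcongr; exact hdelay l
    _ = ENNReal.ofReal (lyap C K (M.ρ / (1 - M.ρ)) / c) := by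
        rw [ENNReal.tsum_mul_right, tsum_ofReal_prior, one_mul]
    _ ≤ _ := by gcongr

/-! ### Comparison of the two bounds. -/

lemma tendsto_ADD_div_iInf (hKL : InformationTheory.klDiv M.P₁ M.P₀ ≠ ∞) {β : ℝ} {a : ℝ → ℝ}
    {b : ℝ → WithBot ℝ} {bmax : ℝ}
    (h : ∀ᶠ α : ℝ in 𝓝[>] 0, b α ≤ (bmax : WithBot ℝ) ∧ a α ≤ Real.log ((1 - α) / α) ∧
      M.twoThreshold (a α) (b α) ∈ M.Feasible α β) :
    Tendsto (fun α : ℝ => M.ADD (M.twoThreshold (a α) (b α)) / ⨅ γ ∈ M.Feasible α β, M.ADD γ)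
      (𝓝[>] 0) (𝓝 1) := by
  have hr := M.rate_pos hKL
  have hlog := tendsto_neg_log_nhdsGT_zero
  -- The upper bound is used with `a' = -log α`, which dominates `log ((1 - α) / α)` and hence `a
  -- α`.
  have hbounds : ∀ c c' : ℝ, 0 < c → c < M.rate → M.rate < c' →
      ∃ C₀ : ℝ, ∀ᶠ α : ℝ in 𝓝[>] 0, 0 < -Real.log α ∧
        ENNReal.ofReal (-Real.log α / c') ≤ ⨅ γ ∈ M.Feasible α β, M.ADD γ ∧
        (⨅ γ ∈ M.Feasible α β, M.ADD γ) ≤ M.ADD (M.twoThreshold (a α) (b α)) ∧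
        M.ADD (M.twoThreshold (a α) (b α)) ≤ ENNReal.ofReal ((-Real.log α + C₀) / c) := by
    intro c c' hc₀ hc hc'
    obtain ⟨C₀, a₀, hub⟩ := M.exists_ADD_twoThreshold_le hKL hc₀ hc bmax
    refine ⟨C₀, ?_⟩
    filter_upwards [h, M.eventually_le_ADD hKL hc', hlog.eventually_ge_atTop a₀,
      hlog.eventually_gt_atTop 0, self_mem_nhdsWithin,
      nhdsWithin_le_nhds (gt_mem_nhds one_pos)] with α hα hlow hα₁ hα₂ hα₃ hα₄
    have hα0 : 0 < α := hα₃
    refine ⟨hα₂, le_iInf₂ fun γ hγ => hlow γ hγ.1, iInf₂_le _ hα.2.2,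
      hub _ hα₁ _ (hα.2.1.trans ?_) _ hα.1⟩
    rw [Real.log_div (by linarith) hα0.ne']
    have := Real.log_nonpos (show 0 ≤ 1 - α by linarith) (by linarith)
    linarith
  refine tendsto_order.mpr ⟨fun t ht => ?_, fun t ht => ?_⟩
  · obtain ⟨C₀, hev⟩ := hbounds (M.rate / 2) (M.rate + 1) (by linarith) (by linarith) (by linarith)
    filter_upwards [hev] with α ⟨h₀, hlow, hle, hup⟩
    refine ht.trans_le ?_
    have hI0 : (⨅ γ ∈ M.Feasible α β, M.ADD γ) ≠ 0 :=
      ((ENNReal.ofReal_pos.mpr (by positivity)).trans_le hlow).ne'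
    have hItop : (⨅ γ ∈ M.Feasible α β, M.ADD γ) ≠ ∞ :=
      ((hle.trans hup).trans_lt ENNReal.ofReal_lt_top).ne
    rw [ENNReal.le_div_iff_mul_le (Or.inl hI0) (Or.inl hItop), one_mul]
    exact hle
  · obtain ⟨s, hs₁, hst⟩ : ∃ s : ℝ, 1 < s ∧ ENNReal.ofReal s < t := by
      obtain ⟨u, hu₁, hut⟩ := exists_between ht
      have hutop : u ≠ ∞ := (hut.trans_le le_top).ne
      refine ⟨u.toReal, ?_, by rwa [ENNReal.ofReal_toReal hutop]⟩
      rw [← ENNReal.toReal_one]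
      exact (ENNReal.toReal_lt_toReal ENNReal.one_ne_top hutop).mpr hu₁
    -- With the rates `rate / u` and `rate * u` the quotient of the bounds tends to `u² = (1 + s) /
    -- 2 < s`.
    set u : ℝ := Real.sqrt ((1 + s) / 2) with hu
    have hu₁ : 1 < u := by
      rw [hu, Real.lt_sqrt zero_le_one]; linarith
    have hus : u * u < s := by
      rw [hu, Real.mul_self_sqrt (by linarith)]; linarith
    have hu0 : 0 < u := zero_lt_one.trans hu₁
    obtain ⟨C₀, hev⟩ := hbounds (M.rate / u) (M.rate * u)
      (div_pos hr hu0) (div_lt_self hr hu₁) (lt_mul_of_one_lt_right hr hu₁)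
    filter_upwards [hev, hlog.eventually_ge_atTop (C₀ * (u * u) / (s - u * u))]
      with α ⟨h₀, hlow, hle, hup⟩ hbig
    set ℓ := -Real.log α with hℓ
    refine lt_of_le_of_lt ?_ hst
    have hℓ' : 0 < ℓ / (M.rate * u) := by positivity
    calc _ ≤ ENNReal.ofReal ((ℓ + C₀) / (M.rate / u)) / ENNReal.ofReal (ℓ / (M.rate * u)) :=
          ENNReal.div_le_div hup hlow
      _ = ENNReal.ofReal ((ℓ + C₀) / (M.rate / u) / (ℓ / (M.rate * u))) :=
          (ENNReal.ofReal_div_of_pos hℓ').symm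
      _ ≤ ENNReal.ofReal s := by
          refine ENNReal.ofReal_le_ofReal ?_
          have he : (ℓ + C₀) / (M.rate / u) / (ℓ / (M.rate * u))
              = (ℓ + C₀) * (u * u) / ℓ := by
            field_simp
          rw [div_le_iff₀ (by linarith)] at hbig
          rw [he, div_le_iff₀ h₀]
          linarith

end ChangeModel
end QCD

theorem mainTheorem4 {𝒳 : Type*} [MeasurableSpace 𝒳] (M : QCD.ChangeModel 𝒳)
    (hKL : InformationTheory.klDiv M.P₁ M.P₀ ≠ ∞) (β : ℝ) (hβ : 0 < β) :
    -- some lower threshold meets the ANO constraint as `a → ∞`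
    (∃ b : WithBot ℝ, ∀ᶠ a : ℝ in atTop, M.ANO (M.twoThreshold a b) ≤ ENNReal.ofReal β) ∧
    -- with such a threshold, the smallest upper threshold for the PFA constraint exists
    (∀ b : WithBot ℝ,
      (∀ᶠ a : ℝ in atTop, M.ANO (M.twoThreshold a b) ≤ ENNReal.ofReal β) →
      ∀ᶠ α : ℝ in 𝓝[>] 0, ∃ a : ℝ,
        IsLeast {a' : ℝ | M.PFA (M.twoThreshold a' b) ≤ ENNReal.ofReal α} a ∧
        b < (a : WithBot ℝ) ∧ a ≤ Real.log ((1 - α) / α) ∧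
        M.twoThreshold a b ∈ M.Feasible α β) ∧
    -- asymptotic optimality for these, and all similar, choices of the thresholds
    (∀ (a : ℝ → ℝ) (b : ℝ → WithBot ℝ) (bmax : ℝ),
      (∀ᶠ α : ℝ in 𝓝[>] 0, b α ≤ (bmax : WithBot ℝ) ∧ a α ≤ Real.log ((1 - α) / α) ∧
        M.twoThreshold (a α) (b α) ∈ M.Feasible α β) →
      Tendsto (fun α : ℝ => M.ADD (M.twoThreshold (a α) (b α)) /
          ⨅ γ ∈ M.Feasible α β, M.ADD γ)
        (𝓝[>] 0) (𝓝 1)) := by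
  have hac := (InformationTheory.klDiv_ne_top_iff.mp hKL).1
  obtain ⟨b, hb⟩ := M.exists_forall_ANO_le hβ
  exact ⟨⟨b, Eventually.of_forall hb⟩, fun b hb => M.exists_isLeast_PFA_le hac hb,
    fun _ _ _ h => M.tendsto_ADD_div_iInf hKL h⟩
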